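/- **Setting.** Let \(N, L, j_0 \ge 1\) be integers, and for \(j \ge j_0\), \(0 \le k < 2^j\) let \(S_{j,k} = 2^{-j}[k-L+1,\,k+L) \cap [0,1)\). Let \(\varphi_{j,k}, \psi_{j,k}\) (\(j \ge j_0\), \(0 \le k < 2^j\)) be a compactly supported orthonormal wavelet basis of \(L^2([0,1])\): these are measurable functions which vanish outside (the closure of) \(S_{j,k}\) and satisfy \(|\varphi_{j,k}|, |\psi_{j,k}| \le B 2^{j/2}\) for a constant \(B\); \(\int_0^1 x^d \psi_{j,k}(x)\,dx = 0\) for \(0 \le d < N\); and for every \(i \ge j_0\) the functions \(\varphi_{i,k}\) (\(0 \le k < 2^i\)) and \(\psi_{j,k}\) (\(j \ge i\), \(0 \le k < 2^j\)) form an orthonormal basis of \(L^2([0,1])\). Write \(\alpha_{j,k} = \int_0^1 f\varphi_{j,k}\) and \(\beta_{j,k} = \int_0^1 f\psi_{j,k}\) for the coefficients of \(f \in L^2([0,1])\). **Function classes.** For \(M>0\) and \(I \subseteq [0,1]\), \(C^s(M,I)\) is the set of \(f \in L^2([0,1])\) with \(2^{j_0(s+\frac12)}|\alpha_{j_0,k}|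 \le M\) whenever \(S_{j_0,k} \subseteq I\), and \(2^{j(s+\frac12)}|\beta_{j,k}| \le M\) whenever \(j \ge j_0\) and \(S_{j,k} \subseteq I\). For \(1 \le p < \infty\), \(B^r_{p,\infty}(M)\) is the set of \(f \in L^2([0,1])\) with \(2^{j_0(r+\frac12-\frac1p)}(\sum_k |\alpha_{j_0,k}|^p)^{1/p} \le M\) and \(2^{j(r+\frac12-\frac1p)}(\sum_k |\beta_{j,k}|^p)^{1/p} \le M\) for all \(j \ge j_0\); and \(B^r_{\infty,\infty}(M) = C^r(M,[0,1])\). For \(t \in (0,1)\), \(D^s_t(M,I)\) is the set of \(f \in C^s(M,I)\) such that for all \(j \ge \lceil j_0/t \rceil\) and all \(k\) with \(S_{j,k} \cap I \ne \emptyset\) there are \(j'\) with \(\lfloor tj \rfloor \le j' < j\) and \(k'\) with \(S_{j',k'} \supseteq S_{j,k}\) and \[|\beta_{j',k'}| \ge (j'/j)\,2^{(j-j')(s+\frac12)}\,|\beta_{j,k}|.\] Let \(p \in [1,\infty]\), \(r \in [\frac12+\frac1p, N)\), \(s \in [r-\frac1p, N)\), \(t \in (0,1)\), \(M>0\), and let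 \(I \subseteq [0,1]\) be an interval with more than one point. Let \(\mathcal F = B^r_{p,\infty}(M) \cap D^s_t(M,I)\), where each function is represented by the pointwise sum of its wavelet series on \([0,1]\). **Adaptive sensing.** Let \(\sigma > 0\) and let \(\varepsilon_1, \varepsilon_2, \dots\) be i.i.d. \(N(0,\sigma^2)\). An adaptive-sensing algorithm consists of (measurable) design points \(x_n = x_n(Y_1,\dots,Y_{n-1}) \in [0,1]\) and estimators \(\hat f_n = \hat f_n(Y_1,\dots,Y_n)\), where \(Y_n = f(x_n) + \varepsilon_n\). For a sequence \(c_n \ge 0\), we say that \(\sup_{x \in I}|\hat f_n(x) - f(x)| = O_p(c_n)\) uniformly over \(f \in \mathcal F\) if for every \(\delta > 0\) there are \(C > 0\) and \(n_0\) with \[\mathbb P\Big(\sup_{x \in I}|\hat f_n(x) - f(x)| > C c_n\Big) \le \delta \quad\text{for all } n \ge n_0 \text{ and all } f \in \mathcal F.\] **Theorem.** Let \(u = \max(r-s,0)\), \(r' = s+tu\), \(s' = s/(1-ptu)\) (with \(s' = s\) if \(p = \infty\), in which case \(u = 0\)), and \(\alpha(v) = v/(2v+1)\). If an adaptive-sensing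 algorithm with estimator \(\hat f_n\) satisfies \[\sup_{x \in I}|\hat f_n(x) - f(x)| = O_p(c_n) \quad \text{uniformly over } f \in \mathcal F,\] then \(c_n \gtrsim n^{-\alpha(\min(r',s'))}\); that is, there are \(c > 0\) and \(n_1\) with \(c_n \ge c\, n^{-\alpha(\min(r',s'))}\) for all \(n \ge n_1\). -/

import Mathlib

open MeasureTheory ProbabilityTheory Filter Topology Asymptotics
open scoped ENNReal NNReal

noncomputable section

/-- The interval `S_{j,k} = 2^{-j} [k - L + 1, k + L) ∩ [0, 1)`. -/
def suppInterval (L j k : ℕ) : Set ℝ :=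
  Set.Ico (((k : ℝ) - L + 1) / 2 ^ j) (((k : ℝ) + L) / 2 ^ j) ∩ Set.Ico 0 1

/-- A compactly supported orthonormal wavelet basis of `L²([0, 1])` with `N` vanishing moments:
scaling functions `φ j k` and wavelets `ψ j k`, for `j₀ ≤ j` and `0 ≤ k < 2 ^ j` (values at other
indices are irrelevant).  They are honest functions, not classes modulo null sets.  They vanish
outside the closure of `S_{j,k}`; the closure differs from `S_{j,k}` in at most one point, and
it is used in order to allow also wavelets that are continuous at the right end of `[0, 1]`.
For every `i ≥ j₀`, the functions `φ i k` and `ψ j k` with `j ≥ i` form an orthonormal basis. -/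
structure WaveletBasis (j₀ L N : ℕ) where
  /-- scaling functions -/
  φ : ℕ → ℕ → ℝ → ℝ
  /-- wavelets -/
  ψ : ℕ → ℕ → ℝ → ℝ
  measurable_φ : ∀ j k, j₀ ≤ j → k < 2 ^ j → Measurable (φ j k)
  measurable_ψ : ∀ j k, j₀ ≤ j → k < 2 ^ j → Measurable (ψ j k)
  support_φ : ∀ j k, j₀ ≤ j → k < 2 ^ j → ∀ x, x ∉ closure (suppInterval L j k) → φ j k x = 0
  support_ψ : ∀ j k, j₀ ≤ j → k < 2 ^ j → ∀ x, x ∉ closure (suppInterval L j k) → ψ j k x = 0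
  /-- the usual size of rescaled copies of finitely many bounded functions -/
  bounded : ∃ B : ℝ, ∀ j k, j₀ ≤ j → k < 2 ^ j → ∀ x,
    |φ j k x| ≤ B * (2 : ℝ) ^ ((j : ℝ) / 2) ∧ |ψ j k x| ≤ B * (2 : ℝ) ^ ((j : ℝ) / 2)
  vanishing_moments : ∀ j k, j₀ ≤ j → k < 2 ^ j → ∀ d < N,
    ∫ x in Set.Icc (0 : ℝ) 1, x ^ d * ψ j k x = 0
  orthonormal_φ : ∀ i, j₀ ≤ i → ∀ k < 2 ^ i, ∀ k' < 2 ^ i,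
    ∫ x in Set.Icc (0 : ℝ) 1, φ i k x * φ i k' x = if k = k' then 1 else 0
  orthogonal_φ_ψ : ∀ i j, j₀ ≤ i → i ≤ j → ∀ k < 2 ^ i, ∀ k' < 2 ^ j,
    ∫ x in Set.Icc (0 : ℝ) 1, φ i k x * ψ j k' x = 0
  orthonormal_ψ : ∀ j j', j₀ ≤ j → j₀ ≤ j' → ∀ k < 2 ^ j, ∀ k' < 2 ^ j',
    ∫ x in Set.Icc (0 : ℝ) 1, ψ j k x * ψ j' k' x = if j = j' ∧ k = k' then 1 else 0
  complete : ∀ i, j₀ ≤ i → ∀ f : ℝ → ℝ, MemLp f 2 (volume.restrict (Set.Icc 0 1)) →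
    (∀ k < 2 ^ i, ∫ x in Set.Icc (0 : ℝ) 1, f x * φ i k x = 0) →
    (∀ j, i ≤ j → ∀ k < 2 ^ j, ∫ x in Set.Icc (0 : ℝ) 1, f x * ψ j k x = 0) →
    f =ᵐ[volume.restrict (Set.Icc 0 1)] 0

namespace WaveletBasis

variable {j₀ L N : ℕ} (W : WaveletBasis j₀ L N)

/-- The scaling coefficient `α_{j,k}` of `f`. -/
def scalingCoeff (f : ℝ → ℝ) (j k : ℕ) : ℝ := ∫ x in Set.Icc (0 : ℝ) 1, f x * W.φ j k x

/-- The wavelet coefficient `β_{j,k}` of `f`. -/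
def waveletCoeff (f : ℝ → ℝ) (j k : ℕ) : ℝ := ∫ x in Set.Icc (0 : ℝ) 1, f x * W.ψ j k x

/-- Functions in `L²([0, 1])` that are equal to the sum of their wavelet series at every point
of `[0, 1]` (and not merely almost everywhere), so that point evaluations make sense. -/
def pointwiseSeries : Set (ℝ → ℝ) :=
  {f | MemLp f 2 (volume.restrict (Set.Icc 0 1)) ∧
    ∀ x ∈ Set.Icc (0 : ℝ) 1,
      HasSum (fun i : ℕ => ∑ k ∈ Finset.range (2 ^ (j₀ + i)),
          W.waveletCoeff f (j₀ + i) k * W.ψ (j₀ + i) k x)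
        (f x - ∑ k ∈ Finset.range (2 ^ j₀), W.scalingCoeff f j₀ k * W.φ j₀ k x)}

/-- The local Hölder class `C^s(M, I)`. -/
def holderClass (s M : ℝ) (I : Set ℝ) : Set (ℝ → ℝ) :=
  {f | MemLp f 2 (volume.restrict (Set.Icc 0 1)) ∧
    (∀ k < 2 ^ j₀, suppInterval L j₀ k ⊆ I →
      (2 : ℝ) ^ ((j₀ : ℝ) * (s + 1 / 2)) * |W.scalingCoeff f j₀ k| ≤ M) ∧
    (∀ j, j₀ ≤ j → ∀ k < 2 ^ j, suppInterval L j k ⊆ I →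
      (2 : ℝ) ^ ((j : ℝ) * (s + 1 / 2)) * |W.waveletCoeff f j k| ≤ M)}

open Classical in
/-- The Besov class `B^r_{p,∞}(M)`, for `1 ≤ p ≤ ∞`. -/
def besovClass (p : ℝ≥0∞) (r M : ℝ) : Set (ℝ → ℝ) :=
  if p = ∞ then W.holderClass r M (Set.Icc 0 1)
  else {f | MemLp f 2 (volume.restrict (Set.Icc 0 1)) ∧
    (2 : ℝ) ^ ((j₀ : ℝ) * (r + 1 / 2 - 1 / p.toReal)) *
      (∑ k ∈ Finset.range (2 ^ j₀), |W.scalingCoeff f j₀ k| ^ p.toReal) ^ (1 / p.toReal) ≤ M ∧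
    ∀ j, j₀ ≤ j → (2 : ℝ) ^ ((j : ℝ) * (r + 1 / 2 - 1 / p.toReal)) *
      (∑ k ∈ Finset.range (2 ^ j), |W.waveletCoeff f j k| ^ p.toReal) ^ (1 / p.toReal) ≤ M}

/-- The detectable class `D^s_t(M, I)`. -/
def detectableClass (s t M : ℝ) (I : Set ℝ) : Set (ℝ → ℝ) :=
  {f | f ∈ W.holderClass s M I ∧
    ∀ j : ℕ, ⌈(j₀ : ℝ) / t⌉₊ ≤ j → ∀ k < 2 ^ j, (suppInterval L j k ∩ I).Nonempty →
      ∃ j' : ℕ, ⌊t * (j : ℝ)⌋₊ ≤ j' ∧ j' < j ∧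
        ∃ k' < 2 ^ j', suppInterval L j k ⊆ suppInterval L j' k' ∧
          ((j' : ℝ) / j) * (2 : ℝ) ^ (((j : ℝ) - j') * (s + 1 / 2)) * |W.waveletCoeff f j k| ≤
            |W.waveletCoeff f j' k'|}

/-- The class `𝓕(p, r, s, t, M, I)` of sparse and detectable functions. -/
def sparseDetectable (p : ℝ≥0∞) (r s t M : ℝ) (I : Set ℝ) : Set (ℝ → ℝ) :=
  W.pointwiseSeries ∩ (W.besovClass p r M ∩ W.detectableClass s t M I)

end WaveletBasis

/-- An adaptive-sensing algorithm.  `design n (Y₁, …, Yₙ)` is the design point `x_{n+1}`, and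
`estimator n (Y₁, …, Yₙ)` is the estimate of `f` after `n` observations. -/
structure AdaptiveSensing where
  design : (n : ℕ) → (Fin n → ℝ) → ℝ
  design_mem : ∀ n y, design n y ∈ Set.Icc (0 : ℝ) 1
  measurable_design : ∀ n, Measurable (design n)
  estimator : (n : ℕ) → (Fin n → ℝ) → ℝ → ℝ
  measurable_estimator : ∀ n x, Measurable (fun y => estimator n y x)

namespace AdaptiveSensing

/-- The observations for the unknown function `f` and the noise sequence `e`:
`obs f e n` is `Y_{n+1} = f (x_{n+1}(Y₁, …, Yₙ)) + e_{n+1}` (indices here start at `0`). -/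
def obs (A : AdaptiveSensing) (f : ℝ → ℝ) (e : ℕ → ℝ) (n : ℕ) : ℝ :=
  f (A.design n (fun i : Fin n => A.obs f e i)) + e n
termination_by n
decreasing_by exact i.2

/-- The estimate of `f` after `n` observations, when `f` is the truth and `e` is the noise. -/
def estimate (A : AdaptiveSensing) (f : ℝ → ℝ) (e : ℕ → ℝ) (n : ℕ) : ℝ → ℝ :=
  A.estimator n (fun i : Fin n => A.obs f e i)

end AdaptiveSensing

/-- The sup-norm distance `sup_{x ∈ I} |g x - f x|`, possibly infinite. -/
def supDist (I : Set ℝ) (g f : ℝ → ℝ) : ℝ≥0∞ := ⨆ x ∈ I, ENNReal.ofReal |g x - f x|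

/-- `sup_{x ∈ I} |f̂ₙ x - f x| = O_p(cₙ)` uniformly over `f ∈ F`, where the noise variables are
`ε 0, ε 1, …` on the probability space `(Ω, P)`. -/
def AchievesRate {Ω : Type*} [MeasurableSpace Ω] (P : Measure Ω) (ε : ℕ → Ω → ℝ)
    (A : AdaptiveSensing) (F : Set (ℝ → ℝ)) (I : Set ℝ) (c : ℕ → ℝ) : Prop :=
  ∀ δ : ℝ, 0 < δ → ∃ C : ℝ, 0 < C ∧ ∃ n₀ : ℕ, ∀ n, n₀ ≤ n → ∀ f ∈ F,
    P {ω | ENNReal.ofReal (C * c n) < supDist I (A.estimate f (fun i => ε i ω) n) f} ≤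
      ENNReal.ofReal δ

/-- The exponent `α(s) = s / (2 s + 1)`. -/
def rateExponent (s : ℝ) : ℝ := s / (2 * s + 1)

end

/-! The bound is a two-point argument. At each large level `j` there are two functions of the class
which differ by one wavelet `η ψ_{j,k}` and which `n` adaptive observations cannot tell apart; the
rate must then be at least of the order of their sup-distance, about `η 2^{j/2}`.

Detectability forbids an isolated spike: a coefficient at level `j` needs a comparable ancestor at
some level from `⌊tj⌋` up to `j - 1`. Hence both functions carry a background on the levels up to `l
= ⌊tj⌋`, active on the whole subtree, down to level `l`, below a node `(a, κ)` and on the ancestors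
of that node. A spike at any of the `2^{j-a}` level-`j` descendants of the node is then legitimate,
and the background does not reveal which one is used. A design point meets at most `2L` wavelets of
level `j`, so the energies of all candidate spikes, averaged over the designs run under the
background, sum to `O(n η² 2^j)`; some candidate therefore has divergence `O(n η² 2^a)`
(`exists_divergence_le`, `exists_hard_pair`). The candidate may depend on the algorithm, which is
why adaptivity does not help.

With `η = b 2^{-j(s+1/2)}` the divergence is `O(n b² 2^{a-j(2s+1)})` and the separation is of order
`b 2^{-js}`. The Besov constraint on the background leaves a trade-off between `b` and `a`. A dense
background, with `a` fixed and `b ≈ 2^{-lu}`, gives `α(r')` (`isBigO_of_dense_levels`); a sparse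
one, with `b` constant and `a ≈ p u l`, gives `α(s')` (`isBigO_of_sparse_levels`). The smaller
exponent is the stronger statement.

The statistical input is a Gaussian change of measure along the adaptive experiment
(`lintegral_obsVec_eq`) and a Le Cam inequality in terms of the divergence
(`exp_neg_half_divergence_le`). -/

/-! ### Change of measure and Le Cam's inequality for adaptive observations. -/

theorem lintegral_gaussianReal_const_add {v : ℝ≥0} (hv : v ≠ 0) (h : ℝ) {G : ℝ → ℝ≥0∞}
    (hG : Measurable G) :
    ∫⁻ z, G (h + z) ∂gaussianReal 0 v =
      ∫⁻ z, G z * ENNReal.ofReal (Real.exp (h * z / v - h ^ 2 / (2 * v))) ∂gaussianReal 0 v := by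
  have hmap : (gaussianReal 0 v).map (h + ·) = gaussianReal h v := by
    rw [gaussianReal_map_const_add, zero_add]
  have hE : Measurable fun z : ℝ =>
      ENNReal.ofReal (Real.exp (h * z / v - h ^ 2 / (2 * v))) := by fun_prop
  have hv' : (v : ℝ) ≠ 0 := by exact_mod_cast hv
  rw [← lintegral_map (f := G) (g := (h + ·)) hG (by fun_prop), hmap,
    gaussianReal_of_var_ne_zero _ hv, gaussianReal_of_var_ne_zero _ hv,
    lintegral_withDensity_eq_lintegral_mul _ (measurable_gaussianPDF _ _) hG,
    lintegral_withDensity_eq_lintegral_mul _ (measurable_gaussianPDF _ _)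
      (show Measurable fun z => G z * _ from hG.mul hE)]
  refine lintegral_congr fun z => ?_
  have : gaussianPDF h v z =
      gaussianPDF 0 v z * ENNReal.ofReal (Real.exp (h * z / v - h ^ 2 / (2 * v))) := by
    rw [gaussianPDF, gaussianPDF, ← ENNReal.ofReal_mul (gaussianPDFReal_nonneg _ _ _),
      gaussianPDFReal, gaussianPDFReal, mul_assoc _ (Real.exp _), ← Real.exp_add]
    congr 3
    field_simp
    ring
  simp only [Pi.mul_apply]
  rw [this]
  ring

namespace AdaptiveSensing

variable (A : AdaptiveSensing) {f f₀ f₁ : ℝ → ℝ}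

/-- The vector of the first `n` observations. -/
def obsVec (f : ℝ → ℝ) (e : ℕ → ℝ) (n : ℕ) : Fin n → ℝ := fun i => A.obs f e i

/-- The design point at which observation `n` is made. -/
noncomputable def point (f : ℝ → ℝ) (e : ℕ → ℝ) (n : ℕ) : ℝ := A.design n (A.obsVec f e n)

theorem obs_eq (f : ℝ → ℝ) (e : ℕ → ℝ) (n : ℕ) :
    A.obs f e n = f (A.point f e n) + e n := by
  rw [obs]; rfl

theorem obs_congr {e e' : ℕ → ℝ} (n : ℕ) (h : ∀ i ≤ n, e i = e' i) :
    A.obs f e n = A.obs f e' n := by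
  induction n using Nat.strong_induction_on with
  | _ n ih =>
    have : A.obsVec f e n = A.obsVec f e' n := by
      funext i
      exact ih i i.2 fun k hk => h k (hk.trans i.2.le)
    rw [obs_eq, obs_eq, point, point, this, h n le_rfl]

theorem obsVec_congr {e e' : ℕ → ℝ} (n : ℕ) (h : ∀ i < n, e i = e' i) :
    A.obsVec f e n = A.obsVec f e' n :=
  funext fun i => A.obs_congr i fun k hk => h k (hk.trans_lt i.2)

theorem obsVec_succ (f : ℝ → ℝ) (e : ℕ → ℝ) (n : ℕ) :
    A.obsVec f e (n + 1) =
      Fin.snoc (α := fun _ => ℝ) (A.obsVec f e n) (f (A.point f e n) + e n) := by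
  funext i
  refine Fin.lastCases ?_ (fun k => ?_) i
  · simp [obsVec, obs_eq]
  · simp [obsVec]

variable {Ω : Type*} [MeasurableSpace Ω]

theorem measurable_obs (hf : Measurable f) {ε : ℕ → Ω → ℝ} (hε : ∀ i, Measurable (ε i)) (n : ℕ) :
    Measurable fun ω => A.obs f (fun i => ε i ω) n := by
  induction n using Nat.strong_induction_on with
  | _ n ih =>
    simp only [obs_eq, point]
    exact (hf.comp ((A.measurable_design n).comp
      (measurable_pi_lambda _ fun i => ih i i.2))).add (hε n)

theorem measurable_obsVec (hf : Measurable f) {ε : ℕ → Ω → ℝ} (hε : ∀ i, Measurable (ε i))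
    (n : ℕ) : Measurable fun ω => A.obsVec f (fun i => ε i ω) n :=
  measurable_pi_lambda _ fun i => A.measurable_obs hf hε i

theorem measurable_point (hf : Measurable f) {ε : ℕ → Ω → ℝ} (hε : ∀ i, Measurable (ε i))
    (n : ℕ) : Measurable fun ω => A.point f (fun i => ε i ω) n :=
  (A.measurable_design n).comp (A.measurable_obsVec hf hε n)

/-- The likelihood ratio of the first `n` observations under `f₁` with respect to `f₀`. -/
noncomputable def likelihoodRatio (f₀ f₁ : ℝ → ℝ) (v : ℝ≥0) : (n : ℕ) → (Fin n → ℝ) → ℝ≥0∞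
  | 0, _ => 1
  | n + 1, y => likelihoodRatio f₀ f₁ v n (Fin.init y) *
      ENNReal.ofReal (Real.exp
        ((f₁ - f₀) (A.design n (Fin.init y)) * (y (Fin.last n) - f₀ (A.design n (Fin.init y))) / v
          - (f₁ - f₀) (A.design n (Fin.init y)) ^ 2 / (2 * v)))

/-- The logarithm of the likelihood ratio, as a function of the noise. -/
noncomputable def logLikelihood (f₀ f₁ : ℝ → ℝ) (v : ℝ≥0) (e : ℕ → ℝ) (n : ℕ) : ℝ :=
  ∑ i ∈ Finset.range n, ((f₁ - f₀) (A.point f₀ e i) * e i / v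
    - (f₁ - f₀) (A.point f₀ e i) ^ 2 / (2 * v))

theorem measurable_init (n : ℕ) :
    Measurable fun y : Fin (n + 1) → ℝ => (Fin.init y : Fin n → ℝ) :=
  measurable_pi_lambda _ fun _ => measurable_pi_apply _

theorem measurable_likelihoodRatio (h₀ : Measurable f₀) (h₁ : Measurable f₁) (v : ℝ≥0) (n : ℕ) :
    Measurable (A.likelihoodRatio f₀ f₁ v n) := by
  induction n with
  | zero => exact measurable_const
  | succ n ih =>
    have hd := (A.measurable_design n).comp (measurable_init n)
    have hh := (h₁.sub h₀).comp hd
    have h0 := h₀.comp hd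
    have hl := measurable_pi_apply (X := fun _ : Fin (n + 1) => ℝ) (Fin.last n)
    refine (ih.comp (measurable_init n)).mul (ENNReal.measurable_ofReal.comp
      (Real.measurable_exp.comp ?_))
    exact ((hh.mul (hl.sub h0)).div_const _).sub ((hh.pow_const 2).div_const _)

/-- Along data generated under `f₀` the residual `Y - f₀(x)` is the noise itself, so the recursive
product collapses to the exponential of a sum. -/
theorem likelihoodRatio_obsVec (v : ℝ≥0) (e : ℕ → ℝ) (n : ℕ) :
    A.likelihoodRatio f₀ f₁ v n (A.obsVec f₀ e n) =
      ENNReal.ofReal (Real.exp (A.logLikelihood f₀ f₁ v e n)) := by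
  induction n with
  | zero => simp [likelihoodRatio, logLikelihood]
  | succ n ih =>
    rw [obsVec_succ, likelihoodRatio, Fin.init_snoc, ih, Fin.snoc_last,
      ← ENNReal.ofReal_mul (Real.exp_pos _).le, ← Real.exp_add, logLikelihood, logLikelihood,
      Finset.sum_range_succ,
      show f₀ (A.point f₀ e n) + e n - f₀ (A.design n (A.obsVec f₀ e n)) = e n from
        add_sub_cancel_left _ _]
    rfl

section Independence

variable {P : Measure Ω} {ε : ℕ → Ω → ℝ}

/-- The first `n` observations are a function of the first `n` noise variables only, whatever the
design rule. -/
theorem indepFun_obsVec (hf : Measurable f) (hε : iIndepFun ε P) (hm : ∀ i, Measurable (ε i))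
    (n : ℕ) : IndepFun (fun ω => A.obsVec f (fun i => ε i ω) n) (ε n) P := by
  have h := hε.indepFun_finset (Finset.range n) {n} (by simp) hm
  -- Padding with zeros turns a finite noise vector into a full sequence; by `obsVec_congr` the
  -- padded values are irrelevant.
  let ext : ((Finset.range n) → ℝ) → ℕ → ℝ :=
    fun w i => if hi : i ∈ Finset.range n then w ⟨i, hi⟩ else 0
  have hext : ∀ i, Measurable fun w => ext w i := fun i => by
    by_cases hi : i ∈ Finset.range n
    · simp only [ext, hi, dite_true]; exact measurable_pi_apply _
    · simp only [ext, hi, dite_false]; exact measurable_const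
  have h' := h.comp (φ := fun w => A.obsVec f (ext w) n)
    (ψ := fun w : (({n} : Finset ℕ)) → ℝ => w ⟨n, Finset.mem_singleton_self n⟩)
    (A.measurable_obsVec (ε := fun i w => ext w i) hf hext n)
    (measurable_pi_apply (X := fun _ : ({n} : Finset ℕ) => ℝ) ⟨n, Finset.mem_singleton_self n⟩)
  have heq : (fun ω => A.obsVec f (fun i => ε i ω) n) =
      (fun w => A.obsVec f (ext w) n) ∘ fun ω (i : Finset.range n) => ε i ω :=
    funext fun ω => A.obsVec_congr n fun i hi => by simp [ext, hi]
  rw [heq]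
  exact h'

variable [IsProbabilityMeasure P] {v : ℝ≥0}

theorem lintegral_obsVec_noise (hf : Measurable f) (hε : iIndepFun ε P)
    (hm : ∀ i, Measurable (ε i)) (hlaw : ∀ i, P.map (ε i) = gaussianReal 0 v) (n : ℕ)
    {F : (Fin n → ℝ) → ℝ → ℝ≥0∞} (hF : Measurable (Function.uncurry F)) :
    ∫⁻ ω, F (A.obsVec f (fun i => ε i ω) n) (ε n ω) ∂P =
      ∫⁻ ω, ∫⁻ z, F (A.obsVec f (fun i => ε i ω) n) z ∂gaussianReal 0 v ∂P := by
  have hY := A.measurable_obsVec hf hm n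
  have h := (indepFun_iff_map_prod_eq_prod_map_map hY.aemeasurable (hm n).aemeasurable).1
    (A.indepFun_obsVec hf hε hm n)
  have h1 := lintegral_map (μ := P) hF (hY.prodMk (hm n))
  simp only [Function.uncurry] at h1
  rw [← h1, h, hlaw, lintegral_prod (fun q => F q.1 q.2) hF.aemeasurable, lintegral_map _ hY]
  · exact hF.lintegral_prod_right'

/-- Induction on the number of observations. Integrating out the last noise leaves a function of the
earlier data, to which the induction hypothesis applies; for fixed earlier data the design point is
fixed, and replacing `f₁` by `f₀` there is a Gaussian shift, which contributes one more factor to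
the likelihood ratio. -/
theorem lintegral_obsVec_eq (hv : v ≠ 0) (h₀ : Measurable f₀) (h₁ : Measurable f₁)
    (hε : iIndepFun ε P) (hm : ∀ i, Measurable (ε i))
    (hlaw : ∀ i, P.map (ε i) = gaussianReal 0 v) (n : ℕ) {G : (Fin n → ℝ) → ℝ≥0∞}
    (hG : Measurable G) :
    ∫⁻ ω, G (A.obsVec f₁ (fun i => ε i ω) n) ∂P =
      ∫⁻ ω, G (A.obsVec f₀ (fun i => ε i ω) n) *
        A.likelihoodRatio f₀ f₁ v n (A.obsVec f₀ (fun i => ε i ω) n) ∂P := by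
  induction n with
  | zero =>
    refine lintegral_congr fun ω => ?_
    rw [likelihoodRatio, mul_one, Subsingleton.elim (A.obsVec f₁ _ 0)]
  | succ n ih =>
    have hsnoc : ∀ g : ℝ → ℝ, Measurable g → Measurable
        fun q : (Fin n → ℝ) × ℝ => (Fin.snoc (α := fun _ => ℝ) q.1 (g (A.design n q.1) + q.2) :
          Fin (n + 1) → ℝ) := fun g hg => by
      refine measurable_pi_lambda _ fun i => ?_
      refine Fin.lastCases ?_ (fun k => ?_) i
      · simp only [Fin.snoc_last]
        exact (hg.comp ((A.measurable_design n).comp measurable_fst)).add measurable_snd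
      · simp only [Fin.snoc_castSucc]
        exact (measurable_pi_apply k).comp measurable_fst
    let F (g : ℝ → ℝ) (y : Fin n → ℝ) (z : ℝ) : ℝ≥0∞ :=
      G (Fin.snoc (α := fun _ => ℝ) y (g (A.design n y) + z))
    have hF : ∀ g, Measurable g → Measurable (Function.uncurry (F g)) := fun g hg =>
      hG.comp (hsnoc g hg)
    let R (y : Fin n → ℝ) (z : ℝ) : ℝ≥0∞ := ENNReal.ofReal (Real.exp
      ((f₁ - f₀) (A.design n y) * z / v - (f₁ - f₀) (A.design n y) ^ 2 / (2 * v)))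
    have hR : Measurable (Function.uncurry R) := by
      have hh := (h₁.sub h₀).comp ((A.measurable_design n).comp
        (measurable_fst : Measurable (Prod.fst : (Fin n → ℝ) × ℝ → _)))
      exact ENNReal.measurable_ofReal.comp (Real.measurable_exp.comp
        (((hh.mul measurable_snd).div_const _).sub ((hh.pow_const 2).div_const _)))
    have hshift : ∀ y, ∫⁻ z, F f₁ y z ∂gaussianReal 0 v =
        ∫⁻ z, F f₀ y z * R y z ∂gaussianReal 0 v := fun y => by
      have hFy : Measurable (F f₀ y) := (hF f₀ h₀).comp measurable_prodMk_left
      rw [← lintegral_gaussianReal_const_add hv ((f₁ - f₀) (A.design n y)) hFy]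
      refine lintegral_congr fun z => ?_
      simp only [F, Pi.sub_apply]
      congr 2
      ring
    have hL := A.measurable_likelihoodRatio h₀ h₁ v n
    calc ∫⁻ ω, G (A.obsVec f₁ (fun i => ε i ω) (n + 1)) ∂P
        = ∫⁻ ω, F f₁ (A.obsVec f₁ (fun i => ε i ω) n) (ε n ω) ∂P := by
          simp only [obsVec_succ]; rfl
      _ = ∫⁻ ω, ∫⁻ z, F f₁ (A.obsVec f₁ (fun i => ε i ω) n) z ∂gaussianReal 0 v ∂P :=
          A.lintegral_obsVec_noise h₁ hε hm hlaw n (hF f₁ h₁)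
      _ = ∫⁻ ω, (∫⁻ z, F f₁ (A.obsVec f₀ (fun i => ε i ω) n) z ∂gaussianReal 0 v) *
            A.likelihoodRatio f₀ f₁ v n (A.obsVec f₀ (fun i => ε i ω) n) ∂P :=
          ih (hF f₁ h₁).lintegral_prod_right'
      _ = ∫⁻ ω, ∫⁻ z, F f₀ (A.obsVec f₀ (fun i => ε i ω) n) z *
            R (A.obsVec f₀ (fun i => ε i ω) n) z *
            A.likelihoodRatio f₀ f₁ v n (A.obsVec f₀ (fun i => ε i ω) n)
              ∂gaussianReal 0 v ∂P := by
          refine lintegral_congr fun ω => ?_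
          rw [hshift, lintegral_mul_const]
          exact (((hF f₀ h₀).mul hR).comp measurable_prodMk_left :)
      _ = ∫⁻ ω, F f₀ (A.obsVec f₀ (fun i => ε i ω) n) (ε n ω) *
            R (A.obsVec f₀ (fun i => ε i ω) n) (ε n ω) *
            A.likelihoodRatio f₀ f₁ v n (A.obsVec f₀ (fun i => ε i ω) n) ∂P := by
          refine (A.lintegral_obsVec_noise h₀ hε hm hlaw n
            (F := fun y z => F f₀ y z * R y z * A.likelihoodRatio f₀ f₁ v n y) ?_).symm
          exact ((hF f₀ h₀).mul hR).mul (hL.comp measurable_fst)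
      _ = _ := by
          refine lintegral_congr fun ω => ?_
          rw [obsVec_succ, likelihoodRatio, Fin.init_snoc, Fin.snoc_last,
            show f₀ (A.point f₀ (fun i => ε i ω) n) + ε n ω -
              f₀ (A.design n (A.obsVec f₀ (fun i => ε i ω) n)) = ε n ω from add_sub_cancel_left _ _]
          simp only [F, R, point]
          ring

/-- The Kullback–Leibler divergence between the first `n` observations under `f₀`
and those under `f₀ + h`. -/
noncomputable def divergence (f₀ h : ℝ → ℝ) (P : Measure Ω) (ε : ℕ → Ω → ℝ) (v : ℝ≥0) (n : ℕ) :
    ℝ :=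
  ∫ ω, ∑ i ∈ Finset.range n, h (A.point f₀ (fun i => ε i ω) i) ^ 2 / (2 * v) ∂P

theorem integrable_sq_point {h : ℝ → ℝ} (h₀ : Measurable f₀) (hh : Measurable h) {H : ℝ}
    (hH : ∀ x, |h x| ≤ H) (hm : ∀ i, Measurable (ε i)) (i : ℕ) :
    Integrable (fun ω => h (A.point f₀ (fun i => ε i ω) i) ^ 2 / (2 * v)) P := by
  refine Integrable.div_const ?_ _
  refine Integrable.of_bound (C := H ^ 2)
    ((hh.comp (A.measurable_point h₀ hm i)).pow_const 2).aestronglyMeasurable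
    (ae_of_all _ fun ω => ?_)
  rw [Real.norm_eq_abs, abs_pow]
  exact pow_le_pow_left₀ (abs_nonneg _) (hH _) 2

/-- The linear terms have mean zero because each design point is independent of the noise at that
step; only the quadratic terms survive. -/
theorem integrable_logLikelihood_and_integral (h₀ : Measurable f₀) (h₁ : Measurable f₁) {H : ℝ}
    (hH : ∀ x, |(f₁ - f₀) x| ≤ H) (hε : iIndepFun ε P) (hm : ∀ i, Measurable (ε i))
    (hlaw : ∀ i, P.map (ε i) = gaussianReal 0 v) (n : ℕ) :
    Integrable (fun ω => A.logLikelihood f₀ f₁ v (fun i => ε i ω) n) P ∧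
      ∫ ω, A.logLikelihood f₀ f₁ v (fun i => ε i ω) n ∂P =
        -A.divergence f₀ (f₁ - f₀) P ε v n := by
  have hh := h₁.sub h₀
  have hp := fun i => hh.comp (A.measurable_point h₀ hm i)
  have hεi : ∀ i, Integrable (ε i) P := fun i => by
    have : Integrable (fun x : ℝ => x) (P.map (ε i)) := by
      rw [hlaw]; exact (memLp_id_gaussianReal 1).integrable le_rfl
    exact this.comp_measurable (hm i)
  have hε0 : ∀ i, ∫ ω, ε i ω ∂P = 0 := fun i => by
    have := integral_map (hm i).aemeasurable (f := fun x : ℝ => x) (μ := P)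
      measurable_id.aestronglyMeasurable
    rw [← this, hlaw, integral_id_gaussianReal]
  have hmul : ∀ i, Integrable (fun ω => (f₁ - f₀) (A.point f₀ (fun i => ε i ω) i) * ε i ω / v) P :=
    fun i => ((hεi i).bdd_mul (hp i).aestronglyMeasurable
      (ae_of_all _ fun ω => by rw [Real.norm_eq_abs]; exact hH _)).div_const _
  have hsq : ∀ i, Integrable
      (fun ω => (f₁ - f₀) (A.point f₀ (fun i => ε i ω) i) ^ 2 / (2 * v)) P :=
    fun i => A.integrable_sq_point h₀ hh hH hm i
  refine ⟨integrable_finsetSum _ fun i _ => (hmul i).sub (hsq i), ?_⟩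
  simp only [logLikelihood, divergence]
  refine (integral_finsetSum _ fun i _ => (hmul i).sub (hsq i)).trans ?_
  rw [integral_finsetSum _ fun i _ => hsq i,
    ← Finset.sum_neg_distrib]
  refine Finset.sum_congr rfl fun i _ => ?_
  refine (integral_sub (hmul i) (hsq i)).trans ?_
  rw [integral_div]
  have hind : IndepFun (fun ω => (f₁ - f₀) (A.point f₀ (fun i => ε i ω) i)) (ε i) P :=
    (A.indepFun_obsVec h₀ hε hm i).comp (φ := fun y => (f₁ - f₀) (A.design i y)) (ψ := id)
      (hh.comp (A.measurable_design i)) measurable_id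
  rw [hind.integral_fun_mul_eq_mul_integral (hp i).aestronglyMeasurable
    (hm i).aestronglyMeasurable, hε0]
  simp

/-- Le Cam's two-point bound for adaptive sensing. -/
theorem exp_neg_half_divergence_le (hv : v ≠ 0) (h₀ : Measurable f₀) (h₁ : Measurable f₁) {H : ℝ}
    (hH : ∀ x, |(f₁ - f₀) x| ≤ H) (hε : iIndepFun ε P) (hm : ∀ i, Measurable (ε i))
    (hlaw : ∀ i, P.map (ε i) = gaussianReal 0 v) (n : ℕ) {S : Set (Fin n → ℝ)}
    (hS : MeasurableSet S) {δ : ℝ} (hδ : 0 < δ)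
    (hP₀ : P {ω | A.obsVec f₀ (fun i => ε i ω) n ∉ S} ≤ ENNReal.ofReal (δ ^ 2))
    (hP₁ : P {ω | A.obsVec f₁ (fun i => ε i ω) n ∈ S} ≤ ENNReal.ofReal (δ ^ 2)) :
    Real.exp (-A.divergence f₀ (f₁ - f₀) P ε v n / 2) ≤ 2 * δ := by
  set K := A.divergence f₀ (f₁ - f₀) P ε v n
  obtain ⟨hℓi, hℓ⟩ := A.integrable_logLikelihood_and_integral h₀ h₁ hH hε hm hlaw n
  set ℓ : Ω → ℝ := fun ω => A.logLikelihood f₀ f₁ v (fun i => ε i ω) n with hℓdef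
  let T : Set Ω := {ω | A.obsVec f₀ (fun i => ε i ω) n ∈ S}
  have hT : MeasurableSet T := A.measurable_obsVec h₀ hm n hS
  have hlr : ∀ S' : Set (Fin n → ℝ), MeasurableSet S' →
      P {ω | A.obsVec f₁ (fun i => ε i ω) n ∈ S'} =
        ∫⁻ ω in {ω | A.obsVec f₀ (fun i => ε i ω) n ∈ S'}, ENNReal.ofReal (Real.exp (ℓ ω)) ∂P := by
    intro S' hS'
    have h := A.lintegral_obsVec_eq hv h₀ h₁ hε hm hlaw n (G := S'.indicator 1)
      (measurable_one.indicator hS')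
    have hT₁ : MeasurableSet {ω | A.obsVec f₁ (fun i => ε i ω) n ∈ S'} :=
      A.measurable_obsVec h₁ hm n hS'
    have hT₀ : MeasurableSet {ω | A.obsVec f₀ (fun i => ε i ω) n ∈ S'} :=
      A.measurable_obsVec h₀ hm n hS'
    rw [← lintegral_indicator_one hT₁, ← lintegral_indicator hT₀]
    refine h.trans (lintegral_congr fun ω => ?_)
    rw [likelihoodRatio_obsVec]
    by_cases hω : A.obsVec f₀ (fun i => ε i ω) n ∈ S' <;> simp [hω, hℓdef]
  have hexpm : AEStronglyMeasurable (fun ω => Real.exp (ℓ ω)) P :=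
    Real.continuous_exp.comp_aestronglyMeasurable hℓi.aestronglyMeasurable
  have hexpi : Integrable (fun ω => Real.exp (ℓ ω)) P := by
    refine ⟨hexpm, ?_⟩
    rw [hasFiniteIntegral_iff_ofReal (ae_of_all _ fun ω => (Real.exp_pos _).le)]
    have := hlr Set.univ MeasurableSet.univ
    simp only [Set.mem_univ, Set.ofPred_true, Measure.restrict_univ, measure_univ] at this
    rw [← this]
    exact ENNReal.one_lt_top
  have hset : ∀ T' : Set Ω, ∫ ω in T', Real.exp (ℓ ω) ∂P =
      (∫⁻ ω in T', ENNReal.ofReal (Real.exp (ℓ ω)) ∂P).toReal := fun T' =>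
    integral_eq_lintegral_of_nonneg_ae (ae_of_all _ fun ω => (Real.exp_pos _).le) hexpm.restrict
  have hT1 : ∫ ω in T, Real.exp (ℓ ω) ∂P ≤ δ ^ 2 := by
    rw [hset, ← hlr S hS]
    exact ENNReal.toReal_le_of_le_ofReal (by positivity) hP₁
  have hT2 : ∫ ω in Tᶜ, Real.exp (ℓ ω) ∂P ≤ 1 := by
    have : Tᶜ = {ω | A.obsVec f₀ (fun i => ε i ω) n ∈ Sᶜ} := rfl
    rw [hset, this, ← hlr Sᶜ hS.compl]
    exact ENNReal.toReal_le_of_le_ofReal zero_le_one (by simpa using prob_le_one)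
  have hT3 : P.real T ≤ 1 := measureReal_le_one
  have hT4 : P.real Tᶜ ≤ δ ^ 2 := ENNReal.toReal_le_of_le_ofReal (by positivity) hP₀
  -- Tangent line of `exp (x / 2)` at `x = -K`, followed by the inequality of arithmetic and
  -- geometric means with weight `a`. As `ℓ` has mean `-K`, the tangent line integrates to exactly
  -- `exp (-K / 2)`.
  have key : ∀ a : ℝ, 0 < a → ∀ x : ℝ,
      Real.exp (-K / 2) * (1 + x / 2 + K / 2) ≤ (a * Real.exp x + a⁻¹) / 2 := by
    intro a ha x
    have h1 : Real.exp (-K / 2) * (1 + x / 2 + K / 2) ≤ Real.exp (x / 2) := by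
      have := Real.add_one_le_exp (x / 2 + K / 2)
      calc _ ≤ Real.exp (-K / 2) * Real.exp (x / 2 + K / 2) :=
            mul_le_mul_of_nonneg_left (by linarith) (Real.exp_pos _).le
        _ = _ := by rw [← Real.exp_add]; congr 1; ring
    refine h1.trans ?_
    have h2 : Real.exp x = Real.exp (x / 2) ^ 2 := by rw [← Real.exp_nat_mul]; congr 1; push_cast; ring
    rw [h2]
    have h3 : a * a⁻¹ = 1 := mul_inv_cancel₀ ha.ne'
    have h4 : 0 ≤ a⁻¹ := by positivity
    nlinarith [mul_nonneg h4 (sq_nonneg (a * Real.exp (x / 2) - 1))]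
  have hlin : Integrable (fun ω => Real.exp (-K / 2) * (1 + ℓ ω / 2 + K / 2)) P :=
    (((integrable_const _).add (hℓi.div_const 2)).add (integrable_const _)).const_mul _
  have hval : ∫ ω, Real.exp (-K / 2) * (1 + ℓ ω / 2 + K / 2) ∂P = Real.exp (-K / 2) := by
    have hs : ∫ ω, (ℓ ω / 2 + (1 + K / 2)) ∂P = 1 := by
      rw [integral_add (hℓi.div_const 2) (integrable_const _), integral_div, hℓ]
      simp
      ring
    rw [integral_const_mul, show (fun ω => 1 + ℓ ω / 2 + K / 2) = fun ω => ℓ ω / 2 + (1 + K / 2)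
      from funext fun ω => by ring, hs, mul_one]
  have hb : ∀ a : ℝ, 0 < a → ∀ T' : Set Ω,
      ∫ ω in T', Real.exp (-K / 2) * (1 + ℓ ω / 2 + K / 2) ∂P ≤
        (a * ∫ ω in T', Real.exp (ℓ ω) ∂P) / 2 + a⁻¹ / 2 * P.real T' := by
    intro a ha T'
    calc _ ≤ ∫ ω in T', (a * Real.exp (ℓ ω) + a⁻¹) / 2 ∂P := by
          refine integral_mono hlin.restrict ?_ fun ω => key a ha _
          exact (((hexpi.restrict).const_mul a).add (integrable_const _)).div_const 2
      _ = _ := by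
          rw [integral_div, integral_add ((hexpi.restrict).const_mul a) (integrable_const _),
            integral_const_mul, integral_const]
          simp
          ring
  have hδ1 : δ⁻¹ * δ ^ 2 = δ := by field_simp
  -- The weights balance the two error probabilities: on `T` the likelihood ratio has mass at most
  -- `δ²`, on `Tᶜ` the measure `P` does. Each part contributes at most `δ`.
  have e1 := hb δ⁻¹ (by positivity) T
  have e2 := hb δ hδ Tᶜ
  rw [← hval, ← integral_add_compl hT hlin]
  rw [inv_inv] at e1
  have hδi : 0 < δ⁻¹ := by positivity
  have m1 := mul_le_mul_of_nonneg_left hT1 hδi.le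
  have m2 := mul_le_mul_of_nonneg_left hT2 hδ.le
  have m3 := mul_le_mul_of_nonneg_left hT3 hδ.le
  have m4 := mul_le_mul_of_nonneg_left hT4 hδi.le
  linarith

end Independence

end AdaptiveSensing
-- Dyadic geometry of the supports.
theorem suppInterval_subset_ancestor {L i j k : ℕ} (hL : 1 ≤ L) (hij : i ≤ j) :
    suppInterval L j k ⊆ suppInterval L i (k / 2 ^ (j - i)) := by
  obtain ⟨d, rfl⟩ := Nat.exists_eq_add_of_le hij
  rw [Nat.add_sub_cancel_left]
  set q := k / 2 ^ d
  have h1 : (q : ℝ) * 2 ^ d ≤ k := by exact_mod_cast Nat.div_mul_le_self k (2 ^ d)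
  have h2 : (k : ℝ) + 1 ≤ (q : ℝ) * 2 ^ d + 2 ^ d := by
    exact_mod_cast Nat.lt_div_mul_add (a := k) (b := 2 ^ d) (by positivity)
  have hL' : (1 : ℝ) ≤ L := by exact_mod_cast hL
  have h3 : (1 : ℝ) ≤ 2 ^ d := one_le_pow₀ (by norm_num)
  have hi : (0 : ℝ) < 2 ^ i := by positivity
  -- This is where `L ≥ 1` enters: the overhang `L - 1` of a fine support is at most the overhang
  -- `(L - 1) 2^d` of its ancestor, in fine units.
  have h4 : 0 ≤ ((L : ℝ) - 1) * (2 ^ d - 1) := mul_nonneg (by linarith) (by linarith)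
  refine Set.inter_subset_inter_left _ (Set.Ico_subset_Ico ?_ ?_)
  · rw [pow_add, div_le_div_iff₀ hi (by positivity)]
    have : ((q : ℝ) - L + 1) * 2 ^ d ≤ k - L + 1 := by nlinarith
    nlinarith
  · rw [pow_add, div_le_div_iff₀ (by positivity) hi]
    have : (k : ℝ) + L ≤ (q + L) * 2 ^ d := by nlinarith
    nlinarith

theorem closure_suppInterval_subset (L j k : ℕ) :
    closure (suppInterval L j k) ⊆
      Set.Icc (((k : ℝ) - L + 1) / 2 ^ j) (((k : ℝ) + L) / 2 ^ j) :=
  closure_minimal (Set.inter_subset_left.trans Set.Ico_subset_Icc_self) isClosed_Icc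

/-- A nondegenerate interval in `[0, 1]` contains the supports of all wavelets below some node. -/
theorem exists_suppInterval_subset {L : ℕ} (hL : 1 ≤ L) {I : Set ℝ} (hI : I ⊆ Set.Icc 0 1)
    (hIint : I.OrdConnected) (hInt : I.Nontrivial) (j₀ : ℕ) :
    ∃ J κ : ℕ, j₀ ≤ J ∧ κ < 2 ^ J ∧ ∀ j, J ≤ j → ∀ k, k / 2 ^ (j - J) = κ →
      Set.Icc (((k : ℝ) - L + 1) / 2 ^ j) (((k : ℝ) + L) / 2 ^ j) ⊆ I := by
  obtain ⟨x, hx, y, hy, hxy⟩ := hInt.exists_lt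
  obtain ⟨J₁, hJ₁⟩ := pow_unbounded_of_one_lt (2 * L / (y - x)) (one_lt_two : (1 : ℝ) < 2)
  set J := max j₀ J₁
  have hyx : 0 < y - x := by linarith
  have hJ : 2 * (L : ℝ) < 2 ^ J * (y - x) := by
    rw [div_lt_iff₀ hyx] at hJ₁
    refine hJ₁.trans_le (mul_le_mul_of_nonneg_right ?_ hyx.le)
    exact pow_le_pow_right₀ (by norm_num) (le_max_right _ _)
  have hx0 := (hI hx).1
  have hy1 := (hI hy).2
  have hpow : (0 : ℝ) < 2 ^ J := by positivity
  set m := ⌈2 ^ J * x⌉₊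
  have hm1 : 2 ^ J * x ≤ m := Nat.le_ceil _
  have hm2 : (m : ℝ) < 2 ^ J * x + 1 := Nat.ceil_lt_add_one (by positivity)
  have hcast : ((m + (L - 1) : ℕ) : ℝ) = m + L - 1 := by
    rw [Nat.cast_add, Nat.cast_sub hL]; push_cast; ring
  -- The shift by `L - 1` puts the left end of the support at `m / 2^J ≥ x`; its right end is `(m +
  -- 2L - 1) / 2^J`, below `y` by the choice of `J`.
  refine ⟨J, m + (L - 1), le_max_left _ _, ?_, fun j hj k hk z hz => hIint.out hx hy ⟨?_, ?_⟩⟩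
  · have hL' : (1 : ℝ) ≤ L := by exact_mod_cast hL
    have : ((m + (L - 1) : ℕ) : ℝ) < 2 ^ J := by rw [hcast]; nlinarith
    exact_mod_cast this
  all_goals
    obtain ⟨d, rfl⟩ := Nat.exists_eq_add_of_le hj
    rw [Nat.add_sub_cancel_left] at hk
    have hL' : (1 : ℝ) ≤ L := by exact_mod_cast hL
    have h3 : (1 : ℝ) ≤ 2 ^ d := one_le_pow₀ (by norm_num)
    have h4 : 0 ≤ ((L : ℝ) - 1) * (2 ^ d - 1) := mul_nonneg (by linarith) (by linarith)
    rw [pow_add] at hz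
  · have h1 : ((m + (L - 1) : ℕ) : ℝ) * 2 ^ d ≤ k := by
      rw [← hk]; exact_mod_cast Nat.div_mul_le_self k (2 ^ d)
    rw [hcast] at h1
    refine le_trans ?_ hz.1
    rw [le_div_iff₀ (by positivity)]
    nlinarith [mul_le_mul_of_nonneg_right hm1 (by positivity : (0 : ℝ) ≤ 2 ^ d)]
  · have h2 : (k : ℝ) + 1 ≤ ((m + (L - 1) : ℕ) : ℝ) * 2 ^ d + 2 ^ d := by
      rw [← hk]; exact_mod_cast Nat.lt_div_mul_add (a := k) (b := 2 ^ d) (by positivity)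
    rw [hcast] at h2
    refine hz.2.trans ?_
    rw [div_le_iff₀ (by positivity)]
    have h5 : (m : ℝ) + 2 * L - 1 ≤ 2 ^ J * y := by nlinarith
    nlinarith [mul_le_mul_of_nonneg_right h5 (by positivity : (0 : ℝ) ≤ 2 ^ d)]

/-! ### Pointwise estimates for wavelets, and class membership of finite wavelet sums. -/

namespace WaveletBasis

variable {j₀ L N : ℕ} (W : WaveletBasis j₀ L N)

/-- For `L = 0` all supports are empty, so a wavelet would vanish and could not have norm one. -/
theorem one_le_L {j₀ L N : ℕ} (W : WaveletBasis j₀ L N) : 1 ≤ L := by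
  by_contra h
  obtain rfl : L = 0 := by omega
  have h1 := W.orthonormal_ψ j₀ j₀ le_rfl le_rfl 0 (by positivity) 0 (by positivity)
  have h2 : ∀ x, W.ψ j₀ 0 x = 0 := fun x => by
    refine W.support_ψ j₀ 0 le_rfl (by positivity) x ?_
    have : suppInterval 0 j₀ 0 = ∅ := by
      rw [suppInterval, Set.Ico_eq_empty, Set.empty_inter]
      simp
    rw [this]
    simp
  simp [h2] at h1

theorem exists_bound : ∃ B : ℝ, 0 < B ∧ ∀ j k, j₀ ≤ j → k < 2 ^ j → ∀ x,
    |W.φ j k x| ≤ B * (2 : ℝ) ^ ((j : ℝ) / 2) ∧ |W.ψ j k x| ≤ B * (2 : ℝ) ^ ((j : ℝ) / 2) := by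
  obtain ⟨B, hB⟩ := W.bounded
  have hle : ∀ j : ℕ, B * (2 : ℝ) ^ ((j : ℝ) / 2) ≤ max B 1 * (2 : ℝ) ^ ((j : ℝ) / 2) := fun j =>
    mul_le_mul_of_nonneg_right (le_max_left _ _) (by positivity)
  exact ⟨max B 1, by positivity, fun j k hj hk x =>
    ⟨(hB j k hj hk x).1.trans (hle j), (hB j k hj hk x).2.trans (hle j)⟩⟩

theorem memLp_φ {j k : ℕ} (hj : j₀ ≤ j) (hk : k < 2 ^ j) :
    MemLp (W.φ j k) 2 (volume.restrict (Set.Icc 0 1)) := by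
  obtain ⟨B, -, hB⟩ := W.exists_bound
  exact MemLp.of_bound (W.measurable_φ j k hj hk).aestronglyMeasurable _
    (ae_of_all _ fun x => (hB j k hj hk x).1)

theorem memLp_ψ {j k : ℕ} (hj : j₀ ≤ j) (hk : k < 2 ^ j) :
    MemLp (W.ψ j k) 2 (volume.restrict (Set.Icc 0 1)) := by
  obtain ⟨B, -, hB⟩ := W.exists_bound
  exact MemLp.of_bound (W.measurable_ψ j k hj hk).aestronglyMeasurable _
    (ae_of_all _ fun x => (hB j k hj hk x).2)

/-- At each point, few wavelets of a given level are active. -/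
theorem sum_sq_ψ_le {B : ℝ} (hB : ∀ j k, j₀ ≤ j → k < 2 ^ j → ∀ x,
    |W.φ j k x| ≤ B * (2 : ℝ) ^ ((j : ℝ) / 2) ∧ |W.ψ j k x| ≤ B * (2 : ℝ) ^ ((j : ℝ) / 2))
    {j : ℕ} (hj : j₀ ≤ j) (x : ℝ) :
    ∑ k ∈ Finset.range (2 ^ j), W.ψ j k x ^ 2 ≤ 2 * L * (B ^ 2 * 2 ^ j) := by
  classical
  set T := (Finset.range (2 ^ j)).filter fun k => W.ψ j k x ≠ 0
  have hT : T.card ≤ 2 * L := by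
    set y : ℝ := 2 ^ j * x
    have hpow : (0 : ℝ) < 2 ^ j := by positivity
    have hmap : ∀ k ∈ T, (k : ℤ) ∈ Finset.Ico ⌊y - L⌋ (⌊y - L⌋ + (2 * L : ℕ)) := by
      intro k hk
      obtain ⟨hk1, hk2⟩ := Finset.mem_filter.1 hk
      have hx : x ∈ closure (suppInterval L j k) := by
        by_contra h
        exact hk2 (W.support_ψ j k hj (Finset.mem_range.1 hk1) x h)
      obtain ⟨ha, hb⟩ := closure_suppInterval_subset L j k hx
      rw [div_le_iff₀ hpow] at ha
      rw [le_div_iff₀ hpow] at hb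
      rw [Finset.mem_Ico]
      have hf1 := Int.floor_le (y - L)
      have hf2 := Int.lt_floor_add_one (y - L)
      constructor
      · have : ((⌊y - L⌋ : ℤ) : ℝ) ≤ ((k : ℤ) : ℝ) := by push_cast; simp only [y] at *; linarith
        exact_mod_cast this
      · have : ((k : ℤ) : ℝ) < ((⌊y - L⌋ + (2 * L : ℕ) : ℤ) : ℝ) := by
          push_cast; simp only [y] at *; linarith
        exact_mod_cast this
    have := Finset.card_le_card_of_injOn (fun k : ℕ => (k : ℤ)) hmap
      (fun a _ b _ h => Int.ofNat.inj h)
    rwa [Int.card_Ico, add_sub_cancel_left, Int.toNat_natCast] at this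
  have hpow : ((2 : ℝ) ^ ((j : ℝ) / 2)) ^ 2 = 2 ^ j := by
    rw [← Real.rpow_natCast, ← Real.rpow_mul (by norm_num), ← Real.rpow_natCast]
    congr 1; push_cast; ring
  calc ∑ k ∈ Finset.range (2 ^ j), W.ψ j k x ^ 2 = ∑ k ∈ T, W.ψ j k x ^ 2 := by
        refine (Finset.sum_filter_of_ne fun k _ h => ?_).symm
        exact fun h0 => h (by rw [h0]; norm_num)
    _ ≤ ∑ k ∈ T, B ^ 2 * 2 ^ j := by
        refine Finset.sum_le_sum fun k hk => ?_
        have := (hB j k hj (Finset.mem_range.1 (Finset.mem_filter.1 hk).1) x).2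
        rw [← hpow, ← mul_pow, ← sq_abs]
        exact pow_le_pow_left₀ (abs_nonneg _) this 2
    _ ≤ _ := by
        rw [Finset.sum_const, nsmul_eq_mul]
        refine mul_le_mul_of_nonneg_right ?_ (by positivity)
        exact_mod_cast hT

/-- A function of norm one supported on an interval of length at most `(2L - 1) / 2^j` cannot have
square below `2^j / (2L)` throughout that interval. -/
theorem exists_le_abs_ψ {j k : ℕ} (hj : j₀ ≤ j) (hk : k < 2 ^ j) :
    ∃ x ∈ Set.Icc (((k : ℝ) - L + 1) / 2 ^ j) (((k : ℝ) + L) / 2 ^ j),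
      2 ^ j / (2 * L) ≤ W.ψ j k x ^ 2 := by
  by_contra! hlt
  have hL : (1 : ℝ) ≤ L := by exact_mod_cast W.one_le_L
  have h1 := W.orthonormal_ψ j j hj hj k hk k hk
  simp only [and_self, if_true] at h1
  have hpow : (0 : ℝ) < 2 ^ j := by positivity
  set Q := Set.Icc (((k : ℝ) - L + 1) / 2 ^ j) (((k : ℝ) + L) / 2 ^ j)
  have hle : ∀ x, W.ψ j k x * W.ψ j k x ≤ Q.indicator (fun _ => (2 : ℝ) ^ j / (2 * L)) x := by
    intro x
    by_cases hx : x ∈ Q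
    · rw [Set.indicator_of_mem hx, ← sq]; exact (hlt x hx).le
    · rw [Set.indicator_of_notMem hx, W.support_ψ j k hj hk x
        fun h => hx (closure_suppInterval_subset L j k h)]
      simp
  have hint : Integrable (Q.indicator fun _ => (2 : ℝ) ^ j / (2 * L)) volume :=
    (integrable_indicator_iff measurableSet_Icc).2 (integrableOn_const (by simp))
  have h2 : (1 : ℝ) ≤ ∫ x, Q.indicator (fun _ => (2 : ℝ) ^ j / (2 * L)) x := by
    rw [← h1]
    refine (integral_mono ((W.memLp_ψ hj hk).integrable_mul (W.memLp_ψ hj hk))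
      hint.restrict hle).trans (setIntegral_le_integral hint (ae_of_all _ fun x => ?_))
    exact Set.indicator_nonneg (fun _ _ => by positivity) x
  rw [integral_indicator measurableSet_Icc, setIntegral_const, smul_eq_mul, measureReal_def,
    Real.volume_Icc, ← sub_div, ENNReal.toReal_ofReal (div_nonneg (by linarith) hpow.le)] at h2
  have : ((k : ℝ) + L - (k - L + 1)) / 2 ^ j * (2 ^ j / (2 * L)) = (2 * L - 1) / (2 * L) := by
    field_simp; ring
  rw [this, le_div_iff₀ (by linarith)] at h2
  linarith

/-- The finite wavelet sum with coefficients `θ` at levels below `m`. -/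
def synth (m : ℕ) (θ : ℕ → ℕ → ℝ) (x : ℝ) : ℝ :=
  ∑ i ∈ Finset.Ico j₀ m, ∑ k ∈ Finset.range (2 ^ i), θ i k * W.ψ i k x

theorem measurable_synth (m : ℕ) (θ : ℕ → ℕ → ℝ) : Measurable (W.synth m θ) :=
  Finset.measurable_fun_sum _ fun i hi => Finset.measurable_fun_sum _ fun k hk =>
    (W.measurable_ψ i k (Finset.mem_Ico.1 hi).1 (Finset.mem_range.1 hk)).const_mul _

theorem memLp_synth (m : ℕ) (θ : ℕ → ℕ → ℝ) :
    MemLp (W.synth m θ) 2 (volume.restrict (Set.Icc 0 1)) :=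
  memLp_finsetSum _ fun _ hi => memLp_finsetSum _ fun _ hk =>
    (W.memLp_ψ (Finset.mem_Ico.1 hi).1 (Finset.mem_range.1 hk)).const_mul _

theorem integral_synth_mul (m : ℕ) (θ : ℕ → ℕ → ℝ) {g : ℝ → ℝ}
    (hg : MemLp g 2 (volume.restrict (Set.Icc 0 1))) :
    ∫ x in Set.Icc (0 : ℝ) 1, W.synth m θ x * g x =
      ∑ i ∈ Finset.Ico j₀ m, ∑ k ∈ Finset.range (2 ^ i),
        θ i k * ∫ x in Set.Icc (0 : ℝ) 1, W.ψ i k x * g x := by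
  have hint : ∀ i ∈ Finset.Ico j₀ m, ∀ k ∈ Finset.range (2 ^ i),
      Integrable (fun x => θ i k * (W.ψ i k x * g x)) (volume.restrict (Set.Icc 0 1)) :=
    fun i hi k hk => ((W.memLp_ψ (Finset.mem_Ico.1 hi).1
      (Finset.mem_range.1 hk)).integrable_mul hg).const_mul _
  simp only [synth, Finset.sum_mul, mul_assoc]
  rw [integral_finsetSum _ fun i hi => integrable_finsetSum _ (hint i hi)]
  refine Finset.sum_congr rfl fun i hi => ?_
  rw [integral_finsetSum _ (hint i hi)]
  exact Finset.sum_congr rfl fun k _ => integral_const_mul _ _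

theorem waveletCoeff_synth {m : ℕ} {θ : ℕ → ℕ → ℝ} (hθ : ∀ i, m ≤ i → ∀ k, θ i k = 0)
    {j k : ℕ} (hj : j₀ ≤ j) (hk : k < 2 ^ j) : W.waveletCoeff (W.synth m θ) j k = θ j k := by
  have hval : ∀ i ∈ Finset.Ico j₀ m, ∀ k' ∈ Finset.range (2 ^ i),
      θ i k' * ∫ x in Set.Icc (0 : ℝ) 1, W.ψ i k' x * W.ψ j k x =
        if i = j ∧ k' = k then θ i k' else 0 := fun i hi k' hk' => by
    rw [W.orthonormal_ψ i j (Finset.mem_Ico.1 hi).1 hj k' (Finset.mem_range.1 hk') k hk]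
    split_ifs <;> simp
  rw [waveletCoeff, W.integral_synth_mul m θ (W.memLp_ψ hj hk),
    Finset.sum_congr rfl fun i hi => Finset.sum_congr rfl (hval i hi)]
  by_cases hjm : j < m
  · rw [Finset.sum_eq_single_of_mem j (Finset.mem_Ico.2 ⟨hj, hjm⟩)
      fun i _ hi => Finset.sum_eq_zero fun k' _ => if_neg fun h => hi h.1,
      Finset.sum_eq_single_of_mem k (Finset.mem_range.2 hk) fun k' _ hk' => if_neg fun h => hk' h.2,
      if_pos ⟨rfl, rfl⟩]
  · rw [hθ j (not_lt.1 hjm) k]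
    refine Finset.sum_eq_zero fun i hi => Finset.sum_eq_zero fun k' _ => if_neg fun h => ?_
    exact hjm (h.1 ▸ (Finset.mem_Ico.1 hi).2)

theorem scalingCoeff_synth (m : ℕ) (θ : ℕ → ℕ → ℝ) {k : ℕ} (hk : k < 2 ^ j₀) :
    W.scalingCoeff (W.synth m θ) j₀ k = 0 := by
  rw [scalingCoeff, W.integral_synth_mul m θ (W.memLp_φ le_rfl hk)]
  refine Finset.sum_eq_zero fun i hi => Finset.sum_eq_zero fun k' hk' => ?_
  simp_rw [mul_comm (W.ψ i k' _)]
  rw [W.orthogonal_φ_ψ j₀ i le_rfl (Finset.mem_Ico.1 hi).1 k hk k' (Finset.mem_range.1 hk'),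
    mul_zero]

theorem synth_mem_pointwiseSeries {m : ℕ} {θ : ℕ → ℕ → ℝ} (hθ : ∀ i, m ≤ i → ∀ k, θ i k = 0) :
    W.synth m θ ∈ W.pointwiseSeries := by
  refine ⟨W.memLp_synth m θ, fun x _ => ?_⟩
  have h0 : ∑ k ∈ Finset.range (2 ^ j₀), W.scalingCoeff (W.synth m θ) j₀ k * W.φ j₀ k x = 0 :=
    Finset.sum_eq_zero fun k hk => by
      rw [W.scalingCoeff_synth m θ (Finset.mem_range.1 hk), zero_mul]
  have h1 : W.synth m θ x = ∑ i ∈ Finset.range (m - j₀), ∑ k ∈ Finset.range (2 ^ (j₀ + i)),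
      W.waveletCoeff (W.synth m θ) (j₀ + i) k * W.ψ (j₀ + i) k x := by
    conv_lhs => rw [synth, Finset.sum_Ico_eq_sum_range]
    refine Finset.sum_congr rfl fun i _ => Finset.sum_congr rfl fun k hk => ?_
    rw [W.waveletCoeff_synth hθ (Nat.le_add_right _ _) (Finset.mem_range.1 hk)]
  rw [h0, sub_zero]
  conv => arg 2; rw [h1]
  refine hasSum_sum_of_ne_finset_zero fun i hi => Finset.sum_eq_zero fun k hk => ?_
  rw [W.waveletCoeff_synth hθ (Nat.le_add_right _ _) (Finset.mem_range.1 hk), hθ _ _ k, zero_mul]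
  rw [Finset.mem_range] at hi
  omega

/-- At most `2^d` nonzero coefficients cost a factor `2^{d/p}` over the largest one in the `ℓ^p`
norm. Writing `1/p` as `p⁻¹.toReal`, which is `0` for `p = ∞`, lets one condition serve both cases
of the definition. -/
theorem synth_mem_besovClass {m : ℕ} {θ : ℕ → ℕ → ℝ} (hθ : ∀ i, m ≤ i → ∀ k, θ i k = 0)
    {p : ℝ≥0∞} (hp : 1 ≤ p) {r s M : ℝ} (hM : 0 < M) {T : ℕ → Finset ℕ} {d : ℕ → ℕ}
    (hT : ∀ i k, k ∉ T i → θ i k = 0) (hd : ∀ i, (T i).card ≤ 2 ^ d i)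
    (hB : ∀ i k : ℕ, (2 : ℝ) ^ ((i : ℝ) * (s + 1 / 2)) * |θ i k| *
      (2 : ℝ) ^ ((i : ℝ) * (r - s - p⁻¹.toReal) + d i * p⁻¹.toReal) ≤ M) :
    W.synth m θ ∈ W.besovClass p r M := by
  have h2 : (0 : ℝ) < 2 := by norm_num
  unfold besovClass
  split_ifs with hp'
  · refine ⟨W.memLp_synth m θ, fun k hk _ => ?_, fun j hj k hk _ => ?_⟩
    · rw [W.scalingCoeff_synth m θ hk, abs_zero, mul_zero]; exact hM.le
    · rw [W.waveletCoeff_synth hθ hj hk]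
      have := hB j k
      rw [hp'] at this
      refine le_trans (le_of_eq ?_) this
      rw [mul_right_comm, ← Real.rpow_add h2]
      congr 2
      simp
      ring
  · have hpr : 1 ≤ p.toReal := by
      rw [← ENNReal.toReal_one]; exact ENNReal.toReal_mono hp' hp
    have hp0 : 0 < p.toReal := by linarith
    have hq : p⁻¹.toReal = 1 / p.toReal := by rw [ENNReal.toReal_inv, one_div]
    rw [hq] at hB
    refine ⟨W.memLp_synth m θ, ?_, fun j hj => ?_⟩
    · rw [Finset.sum_eq_zero fun k hk => ?_, Real.zero_rpow (by positivity), mul_zero]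
      · exact hM.le
      · rw [W.scalingCoeff_synth m θ (Finset.mem_range.1 hk), abs_zero, Real.zero_rpow hp0.ne']
    · rw [Finset.sum_congr rfl fun k hk => by
        rw [W.waveletCoeff_synth hθ hj (Finset.mem_range.1 hk)]]
      set e : ℝ := (j : ℝ) * (s + 1 / 2) + ((j : ℝ) * (r - s - 1 / p.toReal) + d j * (1 / p.toReal))
      have hb : ∀ k, |θ j k| ≤ M * (2 : ℝ) ^ (-e) := fun k => by
        have := hB j k
        rw [mul_right_comm, ← Real.rpow_add h2] at this
        rw [Real.rpow_neg h2.le, ← div_eq_mul_inv, le_div_iff₀ (by positivity), mul_comm]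
        exact this
      have hsum : ∑ k ∈ Finset.range (2 ^ j), |θ j k| ^ p.toReal ≤
          (2 : ℝ) ^ (d j : ℝ) * (M * (2 : ℝ) ^ (-e)) ^ p.toReal := by
        calc ∑ k ∈ Finset.range (2 ^ j), |θ j k| ^ p.toReal
            = ∑ k ∈ (Finset.range (2 ^ j)).filter (· ∈ T j), |θ j k| ^ p.toReal := by
              refine (Finset.sum_filter_of_ne fun k _ hk => ?_).symm
              by_contra h
              exact hk (by rw [hT j k h, abs_zero, Real.zero_rpow hp0.ne'])
          _ ≤ ∑ k ∈ (Finset.range (2 ^ j)).filter (· ∈ T j), (M * (2 : ℝ) ^ (-e)) ^ p.toReal :=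
              Finset.sum_le_sum fun k _ => Real.rpow_le_rpow (abs_nonneg _) (hb k) hp0.le
          _ ≤ _ := by
              rw [Finset.sum_const, nsmul_eq_mul]
              refine mul_le_mul_of_nonneg_right ?_ (by positivity)
              rw [Real.rpow_natCast]
              exact_mod_cast (Finset.card_le_card fun k hk => (Finset.mem_filter.1 hk).2).trans
                (hd j)
      calc _ ≤ (2 : ℝ) ^ ((j : ℝ) * (r + 1 / 2 - 1 / p.toReal)) *
            ((2 : ℝ) ^ (d j : ℝ) * (M * (2 : ℝ) ^ (-e)) ^ p.toReal) ^ (1 / p.toReal) := by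
            refine mul_le_mul_of_nonneg_left (Real.rpow_le_rpow ?_ hsum (by positivity))
              (by positivity)
            exact Finset.sum_nonneg fun k _ => by positivity
        _ = M := by
            rw [Real.mul_rpow (by positivity) (by positivity), ← Real.rpow_mul h2.le,
              ← Real.rpow_mul (by positivity), mul_one_div_cancel hp0.ne', Real.rpow_one,
              mul_left_comm _ M, mul_left_comm _ M, ← Real.rpow_add h2, ← Real.rpow_add h2]
            rw [show (j : ℝ) * (r + 1 / 2 - 1 / p.toReal) + (d j * (1 / p.toReal) + -e) = 0 by
              simp only [e]; ring, Real.rpow_zero, mul_one]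

/-- The domination is asked for without the factor `j' / j ≤ 1`, which only weakens the requirement
of the class. -/
theorem synth_mem_detectableClass {m : ℕ} {θ : ℕ → ℕ → ℝ} (hθ : ∀ i, m ≤ i → ∀ k, θ i k = 0)
    (hj₀ : 1 ≤ j₀) {s t M : ℝ} (ht : t ∈ Set.Ioo (0 : ℝ) 1) (hM : 0 < M) {I : Set ℝ}
    (hH : ∀ i k : ℕ, (2 : ℝ) ^ ((i : ℝ) * (s + 1 / 2)) * |θ i k| ≤ M)
    (hD : ∀ j, j₀ < j → ∀ k < 2 ^ j, ∃ i, j₀ ≤ i ∧ ⌊t * (j : ℝ)⌋₊ ≤ i ∧ i < j ∧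
      (2 : ℝ) ^ (((j : ℝ) - i) * (s + 1 / 2)) * |θ j k| ≤ |θ i (k / 2 ^ (j - i))|) :
    W.synth m θ ∈ W.detectableClass s t M I := by
  refine ⟨⟨W.memLp_synth m θ, fun k hk _ => ?_, fun j hj k hk _ => ?_⟩, fun j hj k hk _ => ?_⟩
  · rw [W.scalingCoeff_synth m θ hk, abs_zero, mul_zero]; exact hM.le
  · rw [W.waveletCoeff_synth hθ hj hk]; exact hH j k
  · have hj' : j₀ < j := by
      have h1 : (j₀ : ℝ) / t ≤ j := Nat.ceil_le.1 hj
      rw [div_le_iff₀ ht.1] at h1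
      have h0 : (1 : ℝ) ≤ j₀ := by exact_mod_cast hj₀
      have h2 : (0 : ℝ) < j := by
        by_contra h
        nlinarith [ht.1]
      have : (j₀ : ℝ) < j := by nlinarith [ht.2]
      exact_mod_cast this
    obtain ⟨i, hi0, hit, hij, h⟩ := hD j hj' k hk
    have hk' : k / 2 ^ (j - i) < 2 ^ i := by
      rw [Nat.div_lt_iff_lt_mul (by positivity), ← pow_add, Nat.add_sub_cancel' hij.le]
      exact hk
    refine ⟨i, hit, hij, k / 2 ^ (j - i), hk', suppInterval_subset_ancestor W.one_le_L hij.le, ?_⟩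
    rw [W.waveletCoeff_synth hθ hj'.le hk, W.waveletCoeff_synth hθ hi0 hk']
    refine le_trans ?_ h
    rw [mul_assoc]
    refine mul_le_of_le_one_left (by positivity) ?_
    exact div_le_one_of_le₀ (by exact_mod_cast hij.le) (by positivity)

end WaveletBasis
-- From indistinguishable pairs to lower bounds on the rate.
namespace AdaptiveSensing

variable (A : AdaptiveSensing) {f₀ f₁ : ℝ → ℝ} {Ω : Type*} [MeasurableSpace Ω] {P : Measure Ω}
  [IsProbabilityMeasure P] {ε : ℕ → Ω → ℝ} {v : ℝ≥0}

/-- If the alternatives `h k`, `k ∈ D`, share the available energy, then one of them is hard to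
detect from `n` adaptive observations. -/
theorem exists_divergence_le (h₀ : Measurable f₀) (hm : ∀ i, Measurable (ε i)) {D : Finset ℕ}
    (hD : D.Nonempty) {h : ℕ → ℝ → ℝ} (hh : ∀ k ∈ D, Measurable (h k))
    {H : ℝ} (hH : ∀ k ∈ D, ∀ x, |h k x| ≤ H) {Q : ℝ} (hQ : ∀ x, ∑ k ∈ D, h k x ^ 2 ≤ Q) (n : ℕ) :
    ∃ k ∈ D, A.divergence f₀ (h k) P ε v n ≤ n * (Q / (2 * v)) / D.card := by
  have hi : ∀ k ∈ D, ∀ i, Integrable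
      (fun ω => h k (A.point f₀ (fun i => ε i ω) i) ^ 2 / (2 * v)) P :=
    fun k hk i => A.integrable_sq_point h₀ (hh k hk) (hH k hk) hm i
  -- Pigeonhole: every divergence is computed with the design run under the same `f₀`, so the sum
  -- over candidates can be taken at each design point.
  refine Finset.exists_le_of_sum_le hD ?_
  have hc : (D.card : ℝ) ≠ 0 := by exact_mod_cast hD.card_ne_zero
  rw [Finset.sum_const, nsmul_eq_mul, mul_div_cancel₀ _ hc]
  simp only [divergence]
  rw [← integral_finsetSum _ fun k hk => integrable_finsetSum _ fun i _ => hi k hk i]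
  calc ∫ ω, ∑ k ∈ D, ∑ i ∈ Finset.range n,
        h k (A.point f₀ (fun i => ε i ω) i) ^ 2 / (2 * v) ∂P
      ≤ ∫ _, (n * (Q / (2 * v)) : ℝ) ∂P := by
        refine integral_mono (integrable_finsetSum _ fun k hk => integrable_finsetSum _
          fun i _ => hi k hk i) (integrable_const _) fun ω => ?_
        simp only
        rw [Finset.sum_comm]
        refine (Finset.sum_le_card_nsmul _ _ (Q / (2 * v)) fun i _ => ?_).trans_eq (by simp)
        rw [← Finset.sum_div]
        exact div_le_div_of_nonneg_right (hQ _) (by positivity)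
    _ = _ := by simp

/-- A uniform rate over a class cannot be faster than the separation of two indistinguishable
members of the class. -/
theorem abs_sub_le_of_indistinguishable (hv : v ≠ 0) (h₀ : Measurable f₀) (h₁ : Measurable f₁)
    {H : ℝ} (hH : ∀ x, |(f₁ - f₀) x| ≤ H) (hε : iIndepFun ε P) (hm : ∀ i, Measurable (ε i))
    (hlaw : ∀ i, P.map (ε i) = gaussianReal 0 v) {n : ℕ} {I : Set ℝ} {x : ℝ} (hx : x ∈ I)
    {τ K δ : ℝ} (hτ : 0 ≤ τ) (hδ : 0 < δ) (hK : A.divergence f₀ (f₁ - f₀) P ε v n ≤ K)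
    (hδK : 2 * δ < Real.exp (-K / 2))
    (hP₀ : P {ω | ENNReal.ofReal τ < supDist I (A.estimate f₀ (fun i => ε i ω) n) f₀} ≤
      ENNReal.ofReal (δ ^ 2))
    (hP₁ : P {ω | ENNReal.ofReal τ < supDist I (A.estimate f₁ (fun i => ε i ω) n) f₁} ≤
      ENNReal.ofReal (δ ^ 2)) :
    |f₁ x - f₀ x| ≤ 2 * τ := by
  by_contra! hsep
  have hsup : ∀ g f : ℝ → ℝ, τ < |g x - f x| → ENNReal.ofReal τ < supDist I g f := fun g f h =>
    ((ENNReal.ofReal_lt_ofReal_iff (hτ.trans_lt h)).2 h).trans_le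
      (le_iSup₂_of_le (f := fun x (_ : x ∈ I) => ENNReal.ofReal |g x - f x|) x hx le_rfl)
  let S : Set (Fin n → ℝ) := {y | |A.estimator n y x - f₀ x| ≤ τ}
  have hS : MeasurableSet S := measurableSet_le
    (((A.measurable_estimator n x).sub_const _).abs) measurable_const
  have := A.exp_neg_half_divergence_le hv h₀ h₁ hH hε hm hlaw n hS hδ
    ((measure_mono fun ω hω => ?_).trans hP₀) ((measure_mono fun ω hω => ?_).trans hP₁)
  · have h2 : Real.exp (-K / 2) ≤ Real.exp (-A.divergence f₀ (f₁ - f₀) P ε v n / 2) :=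
      Real.exp_le_exp.2 (by linarith)
    linarith
  · exact hsup _ _ (not_le.1 hω)
  · refine hsup _ _ ?_
    have h1 : |A.estimator n (A.obsVec f₁ (fun i => ε i ω) n) x - f₀ x| ≤ τ := hω
    change τ < |A.estimator n (A.obsVec f₁ (fun i => ε i ω) n) x - f₁ x|
    have h2 := abs_sub_le (f₁ x) (A.estimator n (A.obsVec f₁ (fun i => ε i ω) n) x) (f₀ x)
    rw [abs_sub_comm (f₁ x) (A.estimator _ _ _)] at h2
    linarith

/-- A lower bound on the uniform rate from separated pairs of indistinguishable functions at all
large resolution levels. -/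
theorem isBigO_of_indistinguishable (hv : v ≠ 0) (hε : iIndepFun ε P)
    (hm : ∀ i, Measurable (ε i)) (hlaw : ∀ i, P.map (ε i) = gaussianReal 0 v)
    {F : Set (ℝ → ℝ)} {I : Set ℝ} {c : ℕ → ℝ} (hc : ∀ n, 0 ≤ c n)
    (hrate : AchievesRate P ε A F I c) {D w b K : ℝ} (hD : 0 < D) (hw : 0 ≤ w) (hb : 0 < b)
    {j₁ : ℕ} (hpair : ∀ j ≥ j₁, ∀ n : ℕ, (n : ℝ) ≤ (2 : ℝ) ^ ((j : ℝ) * D) →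
      ∃ f₀ ∈ F, ∃ f₁ ∈ F, Measurable f₀ ∧ Measurable f₁ ∧ (∃ H, ∀ x, |(f₁ - f₀) x| ≤ H) ∧
        A.divergence f₀ (f₁ - f₀) P ε v n ≤ K ∧
        ∃ x ∈ I, b * (2 : ℝ) ^ (-((j : ℝ) * w)) ≤ |f₁ x - f₀ x|) :
    (fun n : ℕ => (n : ℝ) ^ (-(w / D))) =O[atTop] c := by
  -- With this choice `2 * δ` is strictly below the Le Cam bound. It depends on `K` alone, so a
  -- single constant `C` serves all levels.
  set δ := Real.exp (-K / 2) / 4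
  have hδ : 0 < δ := by positivity
  obtain ⟨C, hC, n₀, hn₀⟩ := hrate (δ ^ 2) (by positivity)
  obtain ⟨n₁, hn₁⟩ := exists_nat_ge ((2 : ℝ) ^ ((j₁ : ℝ) * D))
  refine IsBigO.of_bound (2 * C * 2 ^ w / b) ?_
  filter_upwards [eventually_ge_atTop (max (max n₀ n₁) 1)] with n hn
  have hnn₀ : n₀ ≤ n := (le_max_left _ _).trans ((le_max_left _ _).trans hn)
  have hnn₁ : n₁ ≤ n := (le_max_right _ _).trans ((le_max_left _ _).trans hn)
  have hn1 : (1 : ℝ) ≤ n := by exact_mod_cast (le_max_right _ _).trans hn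
  have hn0 : (0 : ℝ) < n := by linarith
  -- The level used is `⌈y⌉₊`, the first with `n ≤ 2^{jD}`; rounding up costs only the factor `2^w`
  -- in the separation.
  set y := Real.logb 2 n / D
  have hy0 : 0 ≤ y := div_nonneg (Real.logb_nonneg one_lt_two hn1) hD.le
  have hny : (n : ℝ) = 2 ^ (y * D) := by
    rw [div_mul_cancel₀ _ hD.ne', Real.rpow_logb (by norm_num) (by norm_num) hn0]
  have hjn : (n : ℝ) ≤ (2 : ℝ) ^ ((⌈y⌉₊ : ℝ) * D) := by
    rw [hny]
    exact Real.rpow_le_rpow_of_exponent_le one_le_two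
      (mul_le_mul_of_nonneg_right (Nat.le_ceil y) hD.le)
  have hj₁ : j₁ ≤ ⌈y⌉₊ := by
    have h1 : (2 : ℝ) ^ ((j₁ : ℝ) * D) ≤ 2 ^ (y * D) := by
      rw [← hny]; exact hn₁.trans (by exact_mod_cast hnn₁)
    rw [Real.rpow_le_rpow_left_iff one_lt_two, mul_le_mul_iff_left₀ hD] at h1
    exact_mod_cast h1.trans (Nat.le_ceil y)
  obtain ⟨f₀, hf₀, f₁, hf₁, h₀, h₁, ⟨H, hH⟩, hK, x, hx, hsep⟩ := hpair _ hj₁ n hjn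
  have hle := A.abs_sub_le_of_indistinguishable hv h₀ h₁ hH hε hm hlaw hx
    (mul_nonneg hC.le (hc n)) hδ hK (by simp only [δ]; linarith [Real.exp_pos (-K / 2)])
    (hn₀ n hnn₀ f₀ hf₀) (hn₀ n hnn₀ f₁ hf₁)
  have hpow : (n : ℝ) ^ (-(w / D)) ≤ 2 ^ w * (2 : ℝ) ^ (-((⌈y⌉₊ : ℝ) * w)) := by
    rw [hny, ← Real.rpow_mul (by norm_num), ← Real.rpow_add (by norm_num)]
    refine Real.rpow_le_rpow_of_exponent_le one_le_two ?_
    have h1 : y * D * -(w / D) = -(y * w) := by field_simp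
    rw [h1]
    nlinarith [Nat.ceil_lt_add_one hy0]
  rw [Real.norm_of_nonneg (by positivity), Real.norm_of_nonneg (hc n), div_mul_eq_mul_div,
    le_div_iff₀ hb]
  calc (n : ℝ) ^ (-(w / D)) * b ≤ 2 ^ w * (2 : ℝ) ^ (-((⌈y⌉₊ : ℝ) * w)) * b :=
        mul_le_mul_of_nonneg_right hpow hb.le
    _ = 2 ^ w * (b * (2 : ℝ) ^ (-((⌈y⌉₊ : ℝ) * w))) := by ring
    _ ≤ 2 ^ w * (2 * (C * c n)) := mul_le_mul_of_nonneg_left (hsep.trans hle) (by positivity)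
    _ = _ := by ring

end AdaptiveSensing

/-- Allows noise that is only almost everywhere measurable to be replaced by a measurable version;
countably many null sets are discarded. -/
theorem AchievesRate.congr_noise {Ω : Type*} [MeasurableSpace Ω] {P : Measure Ω}
    {ε ε' : ℕ → Ω → ℝ} (h : ∀ i, ε i =ᵐ[P] ε' i) {A : AdaptiveSensing} {F : Set (ℝ → ℝ)}
    {I : Set ℝ} {c : ℕ → ℝ} (hr : AchievesRate P ε A F I c) : AchievesRate P ε' A F I c := by
  intro δ hδ
  obtain ⟨C, hC, n₀, hn₀⟩ := hr δ hδ
  refine ⟨C, hC, n₀, fun n hn f hf => le_of_eq_of_le (measure_congr ?_) (hn₀ n hn f hf)⟩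
  filter_upwards [ae_all_iff.2 h] with ω hω
  have : (fun i => ε' i ω) = fun i => ε i ω := funext fun i => (hω i).symm
  exact congrArg (fun e => ENNReal.ofReal (C * c n) < supDist I (A.estimate f e n) f) this

/-! ### Backgrounds, hard pairs and the two regimes. -/

namespace WaveletBasis

variable {j₀ L N : ℕ} (W : WaveletBasis j₀ L N)

/-- Coefficients of size `b i` on the Hölder scale, at the active positions of each level. -/
noncomputable def activeCoeff (T : ℕ → Finset ℕ) (b : ℕ → ℝ) (s : ℝ) (i k : ℕ) : ℝ :=
  if k ∈ T i then b i * (2 : ℝ) ^ (-((i : ℝ) * (s + 1 / 2))) else 0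

/-- On the Hölder scale an active coefficient is `b i`, so with `b` antitone an active ancestor at a
coarser level dominates automatically: detectability reduces to the combinatorics of the sets `T i`.
-/
theorem synth_activeCoeff_mem (hj₀ : 1 ≤ j₀) {p : ℝ≥0∞} (hp : 1 ≤ p) {r s t M : ℝ}
    (ht : t ∈ Set.Ioo (0 : ℝ) 1) (hM : 0 < M) {I : Set ℝ} {m : ℕ} {T : ℕ → Finset ℕ} {b : ℕ → ℝ}
    {d : ℕ → ℕ} (hm : ∀ i, m ≤ i → T i = ∅) (hd : ∀ i, (T i).card ≤ 2 ^ d i)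
    (hb0 : ∀ i, 0 ≤ b i) (hbM : ∀ i, b i ≤ M) (hanti : Antitone b)
    (hB : ∀ i, (T i).Nonempty →
      b i * (2 : ℝ) ^ ((i : ℝ) * (r - s - p⁻¹.toReal) + d i * p⁻¹.toReal) ≤ M)
    (hD : ∀ j, j₀ < j → ∀ k ∈ T j, ∃ i, j₀ ≤ i ∧ ⌊t * (j : ℝ)⌋₊ ≤ i ∧ i < j ∧
      k / 2 ^ (j - i) ∈ T i) :
    W.synth m (activeCoeff T b s) ∈ W.sparseDetectable p r s t M I := by
  have hθ : ∀ i, m ≤ i → ∀ k, activeCoeff T b s i k = 0 := fun i hi k => by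
    simp [activeCoeff, hm i hi]
  have habs : ∀ i k : ℕ, k ∈ T i →
      (2 : ℝ) ^ ((i : ℝ) * (s + 1 / 2)) * |activeCoeff T b s i k| = b i := fun i k hk => by
    rw [activeCoeff, if_pos hk, abs_of_nonneg (mul_nonneg (hb0 i) (by positivity)), mul_left_comm,
      ← Real.rpow_add (by norm_num), add_neg_cancel, Real.rpow_zero, mul_one]
  have hzero : ∀ i k : ℕ, k ∉ T i → activeCoeff T b s i k = 0 := fun i k hk => if_neg hk
  refine ⟨W.synth_mem_pointwiseSeries hθ, W.synth_mem_besovClass (s := s) (T := T) (d := d) hθ hp hM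
    hzero hd fun i k => ?_, W.synth_mem_detectableClass hθ hj₀ ht hM (fun i k => ?_) fun j hj k hk => ?_⟩
  · by_cases hk : k ∈ T i
    · rw [habs i k hk]; exact hB i ⟨k, hk⟩
    · rw [hzero i k hk, abs_zero, mul_zero, zero_mul]; exact hM.le
  · by_cases hk : k ∈ T i
    · rw [habs i k hk]; exact hbM i
    · rw [hzero i k hk, abs_zero, mul_zero]; exact hM.le
  · by_cases hk' : k ∈ T j
    · obtain ⟨i, h1, h2, h3, h4⟩ := hD j hj k hk'
      refine ⟨i, h1, h2, h3, ?_⟩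
      rw [activeCoeff, if_pos hk', activeCoeff, if_pos h4,
        abs_of_nonneg (mul_nonneg (hb0 i) (by positivity)),
        abs_of_nonneg (mul_nonneg (hb0 j) (by positivity)), mul_left_comm,
        ← Real.rpow_add (by norm_num)]
      rw [show ((j : ℝ) - i) * (s + 1 / 2) + -((j : ℝ) * (s + 1 / 2)) = -((i : ℝ) * (s + 1 / 2))
        by ring]
      exact mul_le_mul_of_nonneg_right (hanti h3.le) (by positivity)
    -- A zero coefficient is dominated by any ancestor; the parent is admissible since `t < 1`.
    · refine ⟨j - 1, by omega, ?_, by omega, ?_⟩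
      · have : ⌊t * (j : ℝ)⌋₊ < j := by
          have hj0 : (0 : ℝ) < j := by exact_mod_cast (by omega : 0 < j)
          rw [Nat.floor_lt (mul_nonneg ht.1.le hj0.le)]
          nlinarith [ht.2]
        omega
      · rw [hzero j k hk', abs_zero, mul_zero]; exact abs_nonneg _

/-- The positions at levels `j₀, …, l` that are ancestors or descendants of the node `(a, κ)`. -/
def lineage (j₀ l a κ i : ℕ) : Finset ℕ :=
  if j₀ ≤ i ∧ i ≤ l then
    (Finset.range (2 ^ i)).filter fun k => k / 2 ^ (i - a) = κ / 2 ^ (a - i)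
  else ∅

theorem card_lineage_le (j₀ l a κ i : ℕ) : (lineage j₀ l a κ i).card ≤ 2 ^ (i - a) := by
  unfold lineage
  split_ifs
  · set q := κ / 2 ^ (a - i)
    have hsub : ((Finset.range (2 ^ i)).filter fun k => k / 2 ^ (i - a) = q) ⊆
        Finset.Ico (q * 2 ^ (i - a)) (q * 2 ^ (i - a) + 2 ^ (i - a)) := fun k hk => by
      rw [Finset.mem_filter] at hk
      rw [Finset.mem_Ico, ← hk.2]
      exact ⟨Nat.div_mul_le_self _ _, Nat.lt_div_mul_add (by positivity)⟩
    simpa using Finset.card_le_card hsub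
  · simp

theorem half_mem_lineage {l a κ j k : ℕ} (hj : j₀ < j) (hk : k ∈ lineage j₀ l a κ j) :
    k / 2 ^ (j - (j - 1)) ∈ lineage j₀ l a κ (j - 1) := by
  unfold lineage at hk ⊢
  split_ifs at hk with h
  · rw [if_pos (by omega)]
    rw [Finset.mem_filter, Finset.mem_range] at hk ⊢
    have hjj : j - (j - 1) = 1 := by omega
    have hpow : 2 ^ j = 2 ^ (j - 1) * 2 := by rw [← pow_succ]; congr 1; omega
    rw [hjj, pow_one]
    refine ⟨by omega, ?_⟩
    rcases le_or_gt a (j - 1) with ha | ha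
    · have e1 : 2 ^ (j - a) = 2 * 2 ^ (j - 1 - a) := by rw [← pow_succ']; congr 1; omega
      have e2 : a - j = 0 := by omega
      have e3 : a - (j - 1) = 0 := by omega
      rw [e3, Nat.div_div_eq_div_mul, ← e1, hk.2, e2]
    · have e1 : 2 ^ (a - (j - 1)) = 2 ^ (a - j) * 2 := by rw [← pow_succ]; congr 1; omega
      have e2 : j - a = 0 := by omega
      have e3 : j - 1 - a = 0 := by omega
      have hk2 := hk.2
      rw [e2, pow_zero, Nat.div_one] at hk2
      rw [e3, pow_zero, Nat.div_one, e1, ← Nat.div_div_eq_div_mul, hk2]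
  · simp at hk

/-- Two functions in the class which differ in a single wavelet at level `j`, and which are
hard to distinguish with `n` adaptive observations. -/
theorem exists_hard_pair (hj₀ : 1 ≤ j₀) {p : ℝ≥0∞} (hp : 1 ≤ p) {r s t M : ℝ}
    (hs : r - p⁻¹.toReal ≤ s) (ht : t ∈ Set.Ioo (0 : ℝ) 1) (hM : 0 < M) {I : Set ℝ}
    {B : ℝ} (hB : ∀ j k, j₀ ≤ j → k < 2 ^ j → ∀ x,
      |W.φ j k x| ≤ B * (2 : ℝ) ^ ((j : ℝ) / 2) ∧ |W.ψ j k x| ≤ B * (2 : ℝ) ^ ((j : ℝ) / 2))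
    {J κ₀ : ℕ} (hJ : j₀ ≤ J) (hκ₀ : κ₀ < 2 ^ J)
    (hsupp : ∀ j, J ≤ j → ∀ k, k / 2 ^ (j - J) = κ₀ →
      Set.Icc (((k : ℝ) - L + 1) / 2 ^ j) (((k : ℝ) + L) / 2 ^ j) ⊆ I)
    {a l j : ℕ} (hJa : J ≤ a) (hal : a ≤ l) (hlj : l < j) (htl : ⌊t * (j : ℝ)⌋₊ ≤ l)
    {b : ℕ → ℝ} (hb0 : ∀ i, 0 ≤ b i) (hbM : ∀ i, b i ≤ M) (hanti : Antitone b)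
    (hbB : ∀ i ≤ l,
      b i * (2 : ℝ) ^ ((i : ℝ) * (r - s - p⁻¹.toReal) + (i - a : ℕ) * p⁻¹.toReal) ≤ M)
    (A : AdaptiveSensing) {Ω : Type*} [MeasurableSpace Ω] {P : Measure Ω}
    [IsProbabilityMeasure P] {ε : ℕ → Ω → ℝ} (hm : ∀ i, Measurable (ε i)) {v : ℝ≥0}
    (n : ℕ) :
    ∃ f₀ ∈ W.sparseDetectable p r s t M I, ∃ f₁ ∈ W.sparseDetectable p r s t M I,
      Measurable f₀ ∧ Measurable f₁ ∧ (∃ H, ∀ x, |(f₁ - f₀) x| ≤ H) ∧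
      A.divergence f₀ (f₁ - f₀) P ε v n ≤
        L * B ^ 2 / v * (n * (b j ^ 2 * (2 : ℝ) ^ (-((j : ℝ) * (2 * s + 1)) + a))) ∧
      ∃ x ∈ I, (√(2 * L))⁻¹ * (b j * (2 : ℝ) ^ (-((j : ℝ) * s))) ≤ |f₁ x - f₀ x| := by
  classical
  have h2 : (0 : ℝ) < 2 := by norm_num
  have hj₀j : j₀ ≤ j := by omega
  -- The leftmost descendant of `κ₀` at level `a`. `D` below consists of its descendants at level
  -- `j`, the candidate positions of the spike.
  set κ := κ₀ * 2 ^ (a - J)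
  have hκ : κ < 2 ^ a := by
    have : 2 ^ a = 2 ^ J * 2 ^ (a - J) := by rw [← pow_add]; congr 1; omega
    rw [this]
    exact Nat.mul_lt_mul_of_pos_right hκ₀ (by positivity)
  set η : ℝ := b j * (2 : ℝ) ^ (-((j : ℝ) * (s + 1 / 2)))
  have hη0 : 0 ≤ η := mul_nonneg (hb0 j) (by positivity)
  set T := lineage j₀ l a κ
  have hTl : ∀ i, l < i → T i = ∅ := fun i hi => if_neg (by omega)
  set f₀ := W.synth (j + 1) (activeCoeff T b s)
  have hf₀m : Measurable f₀ := W.measurable_synth _ _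
  set D := Finset.Ico (κ * 2 ^ (j - a)) (κ * 2 ^ (j - a) + 2 ^ (j - a))
  have hDcard : D.card = 2 ^ (j - a) := by simp [D]
  have hDne : D.Nonempty := by rw [← Finset.card_pos, hDcard]; positivity
  have hDdiv : ∀ k ∈ D, k / 2 ^ (j - a) = κ := fun k hk => by
    obtain ⟨h1, h2⟩ := Finset.mem_Ico.1 hk
    exact Nat.div_eq_of_lt_le h1 (by rw [add_mul, one_mul]; exact h2)
  have hDlt : ∀ k ∈ D, k < 2 ^ j := fun k hk => by
    have h1 : k / 2 ^ (j - a) < 2 ^ a := by rw [hDdiv k hk]; exact hκ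
    rw [Nat.div_lt_iff_lt_mul (by positivity), ← pow_add] at h1
    rwa [show a + (j - a) = j by omega] at h1
  have hsumD : ∀ x, ∑ k ∈ D, (η * W.ψ j k x) ^ 2 ≤ η ^ 2 * (2 * L * (B ^ 2 * 2 ^ j)) := fun x => by
    simp only [mul_pow]
    rw [← Finset.mul_sum]
    refine mul_le_mul_of_nonneg_left (le_trans ?_ (W.sum_sq_ψ_le hB hj₀j x)) (sq_nonneg _)
    exact Finset.sum_le_sum_of_subset_of_nonneg
      (fun k hk => Finset.mem_range.2 (hDlt k hk)) fun _ _ _ => sq_nonneg _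
  have hbd : ∀ k ∈ D, ∀ x, |η * W.ψ j k x| ≤ η * (B * (2 : ℝ) ^ ((j : ℝ) / 2)) := fun k hk x => by
    rw [abs_mul, abs_of_nonneg hη0]
    exact mul_le_mul_of_nonneg_left (hB j k hj₀j (hDlt k hk) x).2 hη0
  obtain ⟨k₀, hk₀, hdiv⟩ := A.exists_divergence_le (P := P) (v := v) hf₀m hm hDne
    (h := fun k x => η * W.ψ j k x)
    (fun k hk => (W.measurable_ψ j k hj₀j (hDlt k hk)).const_mul η) hbd hsumD n
  -- The background has no coefficient at level `j`, so this adds exactly the spike chosen by the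
  -- pigeonhole step.
  set T' : ℕ → Finset ℕ := fun i => if i = j then {k₀} else T i
  set f₁ := W.synth (j + 1) (activeCoeff T' b s)
  have hdiff : f₁ - f₀ = fun x => η * W.ψ j k₀ x := by
    funext x
    simp only [f₁, f₀, Pi.sub_apply, synth]
    rw [← Finset.sum_sub_distrib, Finset.sum_eq_single_of_mem j (by simp; omega)
      fun i _ hi => ?_]
    · rw [← Finset.sum_sub_distrib,
        Finset.sum_eq_single_of_mem k₀ (Finset.mem_range.2 (hDlt k₀ hk₀)) fun k _ hk => ?_]
      · simp [activeCoeff, T', hTl j hlj, η]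
      · simp [activeCoeff, T', hTl j hlj, hk]
    · simp [activeCoeff, T', hi]
  have hstep : ∀ i, j₀ < i → ∀ k ∈ T i, ∃ i', j₀ ≤ i' ∧ ⌊t * (i : ℝ)⌋₊ ≤ i' ∧ i' < i ∧
      k / 2 ^ (i - i') ∈ T i' := fun i hi k hk => by
    refine ⟨i - 1, by omega, ?_, by omega, half_mem_lineage hi hk⟩
    have : ⌊t * (i : ℝ)⌋₊ < i := by
      have hi0 : (0 : ℝ) < i := by exact_mod_cast (by omega : 0 < i)
      rw [Nat.floor_lt (mul_nonneg ht.1.le hi0.le)]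
      nlinarith [ht.2]
    omega
  have hTle : ∀ i, (T i).Nonempty → i ≤ l := fun i hi => by
    by_contra h
    rw [hTl i (not_le.1 h)] at hi
    exact Finset.not_nonempty_empty hi
  have hf₀ : f₀ ∈ W.sparseDetectable p r s t M I :=
    W.synth_activeCoeff_mem hj₀ hp ht hM (fun i hi => hTl i (by omega))
      (card_lineage_le j₀ l a κ) hb0 hbM hanti (fun i hi => hbB i (hTle i hi)) hstep
  have hf₁ : f₁ ∈ W.sparseDetectable p r s t M I := by
    refine W.synth_activeCoeff_mem (d := fun i => if i = j then 0 else i - a) hj₀ hp ht hM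
      (fun i hi => ?_) (fun i => ?_) hb0 hbM hanti (fun i hi => ?_) fun i hi k hk => ?_
    · simp only [T']; rw [if_neg (by omega)]; exact hTl i (by omega)
    · by_cases hij : i = j
      · simp [T', hij]
      · simp only [T', hij, if_false]; exact card_lineage_le j₀ l a κ i
    · by_cases hij : i = j
      -- A single spike meets the Besov bound at full Hölder size because `r - 1/p ≤ s`.
      · simp only [hij, if_true, Nat.cast_zero, zero_mul, add_zero]
        refine (mul_le_of_le_one_right (hb0 j) ?_).trans (hbM j)
        refine Real.rpow_le_one_of_one_le_of_nonpos one_le_two ?_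
        exact mul_nonpos_of_nonneg_of_nonpos (by positivity) (by linarith)
      · simp only [T', hij, if_false] at hi ⊢
        exact hbB i (hTle i hi)
    · by_cases hij : i = j
      · subst hij
        simp only [T', if_true, Finset.mem_singleton] at hk
        subst hk
        -- The spike is detected at level `l`, where every descendant of `κ` is active; the levels
        -- strictly between `l` and `j` stay empty.
        refine ⟨l, by omega, htl, hlj, ?_⟩
        simp only [T', hlj.ne, if_false]
        simp only [T, lineage]
        rw [if_pos ⟨by omega, le_rfl⟩, Finset.mem_filter, Finset.mem_range,
          Nat.div_div_eq_div_mul, ← pow_add, show i - l + (l - a) = i - a by omega, hDdiv k hk₀,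
          show a - l = 0 by omega, pow_zero, Nat.div_one]
        refine ⟨?_, rfl⟩
        rw [Nat.div_lt_iff_lt_mul (by positivity), ← pow_add, Nat.add_sub_cancel' hlj.le]
        exact hDlt k hk₀
      · simp only [T', hij, if_false] at hk
        obtain ⟨i', h1, h3, h4, h5⟩ := hstep i hi k hk
        have hi'j : i' ≠ j := by
          have := hTle i ⟨k, hk⟩
          omega
        exact ⟨i', h1, h3, h4, by simpa only [T', hi'j, if_false] using h5⟩
  obtain ⟨x, hx, hψx⟩ := W.exists_le_abs_ψ hj₀j (hDlt k₀ hk₀)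
  refine ⟨f₀, hf₀, f₁, hf₁, hf₀m, W.measurable_synth _ _,
    ⟨η * (B * (2 : ℝ) ^ ((j : ℝ) / 2)), fun x => ?_⟩, ?_, x, ?_, ?_⟩
  · rw [hdiff]; exact hbd k₀ hk₀ x
  · rw [hdiff]
    refine hdiv.trans_eq ?_
    have e1 : η ^ 2 * 2 ^ j / 2 ^ (j - a) =
        b j ^ 2 * (2 : ℝ) ^ (-((j : ℝ) * (2 * s + 1)) + a) := by
      simp only [η]
      rw [mul_pow, ← Real.rpow_natCast ((2 : ℝ) ^ _) 2, ← Real.rpow_mul h2.le, mul_assoc,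
        mul_div_assoc, ← Real.rpow_natCast 2 j, ← Real.rpow_natCast 2 (j - a),
        Nat.cast_sub (by omega), ← Real.rpow_add h2, ← Real.rpow_sub h2]
      congr 2
      push_cast
      ring
    rw [hDcard, ← e1]
    push_cast
    ring
  · refine hsupp j (by omega) k₀ ?_ hx
    have : 2 ^ (j - J) = 2 ^ (j - a) * 2 ^ (a - J) := by rw [← pow_add]; congr 1; omega
    rw [this, ← Nat.div_div_eq_div_mul, hDdiv k₀ hk₀]
    exact Nat.mul_div_cancel _ (by positivity)
  · have e1 : |f₁ x - f₀ x| = η * |W.ψ j k₀ x| := by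
      have := congrFun hdiff x
      rw [Pi.sub_apply] at this
      rw [this, abs_mul, abs_of_nonneg hη0]
    have e2 : (√(2 * L))⁻¹ * (2 : ℝ) ^ ((j : ℝ) / 2) ≤ |W.ψ j k₀ x| := by
      refine Real.le_sqrt_of_sq_le ?_ |>.trans_eq (Real.sqrt_sq_eq_abs _)
      refine le_trans (le_of_eq ?_) hψx
      rw [mul_pow, inv_pow, Real.sq_sqrt (by positivity), ← Real.rpow_natCast ((2 : ℝ) ^ _) 2,
        ← Real.rpow_mul h2.le, ← Real.rpow_natCast 2 j, div_eq_inv_mul,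
        show 2⁻¹ * (j : ℝ) * (2 : ℕ) = j by push_cast; ring, inv_mul_eq_div]
    rw [e1]
    refine le_trans (le_of_eq ?_) (mul_le_mul_of_nonneg_left e2 hη0)
    simp only [η]
    rw [show -((j : ℝ) * s) = -((j : ℝ) * (s + 1 / 2)) + (j : ℝ) / 2 by ring, Real.rpow_add h2]
    ring

theorem le_floor_mul_and_floor_mul_lt {J j : ℕ} {t : ℝ} (hJ : 1 ≤ J) (ht0 : 0 < t) (ht1 : t < 1)
    (hj : ⌈(J : ℝ) / t⌉₊ ≤ j) : J ≤ ⌊t * (j : ℝ)⌋₊ ∧ ⌊t * (j : ℝ)⌋₊ < j := by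
  have h1 : (J : ℝ) / t ≤ j := Nat.ceil_le.1 hj
  rw [div_le_iff₀ ht0, mul_comm] at h1
  have hJ1 : (1 : ℝ) ≤ J := by exact_mod_cast hJ
  have hj0 : (0 : ℝ) < j := by
    by_contra h
    nlinarith
  refine ⟨Nat.le_floor h1, ?_⟩
  rw [Nat.floor_lt (by positivity)]
  nlinarith

/-- The lower bound obtained by filling all positions of the coarse levels with small
coefficients. -/
theorem isBigO_of_dense_levels (hj₀ : 1 ≤ j₀) {p : ℝ≥0∞} (hp : 1 ≤ p) {r s t M u : ℝ}
    (hs : r - p⁻¹.toReal ≤ s) (hs0 : 0 < s) (ht : t ∈ Set.Ioo (0 : ℝ) 1) (hM : 0 < M)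
    (hu0 : 0 ≤ u) (hru : r - s ≤ u)
    {I : Set ℝ} (hI : I ⊆ Set.Icc 0 1) (hIint : I.OrdConnected) (hInt : I.Nontrivial)
    {Ω : Type*} [MeasurableSpace Ω] {P : Measure Ω} [IsProbabilityMeasure P] {ε : ℕ → Ω → ℝ}
    {v : ℝ≥0} (hv : v ≠ 0) (hε : iIndepFun ε P) (hm : ∀ i, Measurable (ε i))
    (hlaw : ∀ i, P.map (ε i) = gaussianReal 0 v) (A : AdaptiveSensing) {c : ℕ → ℝ}
    (hc : ∀ n, 0 ≤ c n) (hrate : AchievesRate P ε A (W.sparseDetectable p r s t M I) I c) :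
    (fun n : ℕ => (n : ℝ) ^ (-((s + t * u) / (2 * (s + t * u) + 1)))) =O[atTop] c := by
  have h2 : (0 : ℝ) < 2 := by norm_num
  obtain ⟨ht0, ht1⟩ := ht
  have hL : (1 : ℝ) ≤ L := by exact_mod_cast W.one_le_L
  obtain ⟨B, hBpos, hB⟩ := W.exists_bound
  obtain ⟨J, κ₀, hJ, hκ₀, hsupp⟩ := exists_suppInterval_subset W.one_le_L hI hIint hInt j₀
  have hq0 : 0 ≤ p⁻¹.toReal := ENNReal.toReal_nonneg
  refine A.isBigO_of_indistinguishable hv hε hm hlaw hc hrate (D := 2 * (s + t * u) + 1)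
    (w := s + t * u) (b := (√(2 * L))⁻¹ * M) (K := L * B ^ 2 / (v : ℝ≥0) * (M ^ 2 * 2 ^ (2 * u + J)))
    (by positivity) (by positivity) (by positivity) (j₁ := ⌈(J : ℝ) / t⌉₊) fun j hj n hn => ?_
  obtain ⟨hJl, hlj⟩ := le_floor_mul_and_floor_mul_lt (hj₀.trans hJ) ht0 ht1 hj
  set l := ⌊t * (j : ℝ)⌋₊
  have hl1 : (l : ℝ) ≤ t * j := Nat.floor_le (by positivity)
  have hl2 : t * j < l + 1 := Nat.lt_floor_add_one _
  -- The decay `2^{-iu}` pays for filling the whole subtree. Freezing it beyond `l` keeps `b`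
  -- antitone and gives the spike the size `b l` of its detecting ancestor.
  set b : ℕ → ℝ := fun i => M * (2 : ℝ) ^ (-((min i l : ℕ) * u))
  have hbj : b j = M * (2 : ℝ) ^ (-(l * u)) := by simp only [b, min_eq_right hlj.le]
  have hcond : ∀ i ≤ l, b i * (2 : ℝ) ^ ((i : ℝ) * (r - s - p⁻¹.toReal) +
      (i - J : ℕ) * p⁻¹.toReal) ≤ M := fun i hi => by
    simp only [b, min_eq_left hi]
    rw [mul_assoc, ← Real.rpow_add h2]
    refine mul_le_of_le_one_right hM.le (Real.rpow_le_one_of_one_le_of_nonpos one_le_two ?_)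
    have h3 : ((i - J : ℕ) : ℝ) ≤ i := by exact_mod_cast Nat.sub_le i J
    have h4 : (0 : ℝ) ≤ i := by positivity
    nlinarith [mul_le_mul_of_nonneg_right h3 hq0, mul_le_mul_of_nonneg_left hru h4]
  obtain ⟨f₀, hf₀, f₁, hf₁, h₀, h₁, hH, hdiv, x, hx, hsep⟩ :=
    W.exists_hard_pair hj₀ hp hs ⟨ht0, ht1⟩ hM hB hJ hκ₀ hsupp (a := J) le_rfl hJl hlj le_rfl
      (b := b) (fun i => by positivity)
      (fun i => mul_le_of_le_one_right hM.le (Real.rpow_le_one_of_one_le_of_nonpos one_le_two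
        (neg_nonpos.2 (by positivity))))
      (fun i i' hii' => mul_le_mul_of_nonneg_left (Real.rpow_le_rpow_of_exponent_le one_le_two
        (neg_le_neg (mul_le_mul_of_nonneg_right
          (by exact_mod_cast min_le_min_right l hii') hu0))) hM.le)
      hcond A (P := P) hm (v := v) n
  refine ⟨f₀, hf₀, f₁, hf₁, h₀, h₁, hH, hdiv.trans ?_, x, hx, le_trans ?_ hsep⟩
  · refine mul_le_mul_of_nonneg_left ?_ (by positivity)
    refine (mul_le_mul_of_nonneg_right hn (by positivity)).trans ?_
    rw [hbj, mul_pow, ← Real.rpow_natCast ((2 : ℝ) ^ _) 2, ← Real.rpow_mul h2.le, mul_assoc,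
      mul_left_comm, ← Real.rpow_add h2, ← Real.rpow_add h2]
    refine mul_le_mul_of_nonneg_left (Real.rpow_le_rpow_of_exponent_le one_le_two ?_)
      (by positivity)
    -- Rounding `tj` down to `l` costs `2 * u` in the exponent and the fixed node costs `J`, whence
    -- the constant `K`.
    push_cast
    nlinarith
  · rw [mul_assoc, hbj, mul_assoc, ← Real.rpow_add h2]
    refine mul_le_mul_of_nonneg_left (mul_le_mul_of_nonneg_left
      (Real.rpow_le_rpow_of_exponent_le one_le_two ?_) hM.le) (by positivity)
    nlinarith

/-- The lower bound obtained by filling few positions of the coarse levels with coefficients of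
maximal size. -/
theorem isBigO_of_sparse_levels (hj₀ : 1 ≤ j₀) {p : ℝ≥0∞} (hp : 1 ≤ p) {r s t M π : ℝ}
    (hs : r - p⁻¹.toReal ≤ s) (hs0 : 0 < s) (ht : t ∈ Set.Ioo (0 : ℝ) 1) (hM : 0 < M)
    (hπ0 : 0 ≤ π) (hπ1 : π ≤ 1) (hru : r - s ≤ π * p⁻¹.toReal)
    {I : Set ℝ} (hI : I ⊆ Set.Icc 0 1) (hIint : I.OrdConnected) (hInt : I.Nontrivial)
    {Ω : Type*} [MeasurableSpace Ω] {P : Measure Ω} [IsProbabilityMeasure P] {ε : ℕ → Ω → ℝ}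
    {v : ℝ≥0} (hv : v ≠ 0) (hε : iIndepFun ε P) (hm : ∀ i, Measurable (ε i))
    (hlaw : ∀ i, P.map (ε i) = gaussianReal 0 v) (A : AdaptiveSensing) {c : ℕ → ℝ}
    (hc : ∀ n, 0 ≤ c n) (hrate : AchievesRate P ε A (W.sparseDetectable p r s t M I) I c) :
    (fun n : ℕ => (n : ℝ) ^ (-(s / (2 * s + 1 - t * π)))) =O[atTop] c := by
  have h2 : (0 : ℝ) < 2 := by norm_num
  obtain ⟨ht0, ht1⟩ := ht
  have hL : (1 : ℝ) ≤ L := by exact_mod_cast W.one_le_L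
  obtain ⟨B, hBpos, hB⟩ := W.exists_bound
  obtain ⟨J, κ₀, hJ, hκ₀, hsupp⟩ := exists_suppInterval_subset W.one_le_L hI hIint hInt j₀
  have hq0 : 0 ≤ p⁻¹.toReal := ENNReal.toReal_nonneg
  have htπ : t * π < 1 := by nlinarith
  refine A.isBigO_of_indistinguishable hv hε hm hlaw hc hrate (D := 2 * s + 1 - t * π) (w := s)
    (b := (√(2 * L))⁻¹ * M) (K := L * B ^ 2 / (v : ℝ≥0) * (M ^ 2 * 2 ^ ((J : ℝ) + 1)))
    (by linarith) hs0.le (by positivity) (j₁ := ⌈(J : ℝ) / t⌉₊) fun j hj n hn => ?_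
  obtain ⟨hJl, hlj⟩ := le_floor_mul_and_floor_mul_lt (hj₀.trans hJ) ht0 ht1 hj
  set l := ⌊t * (j : ℝ)⌋₊
  have hl1 : (l : ℝ) ≤ t * j := Nat.floor_le (by positivity)
  have hlπ : ⌈l * π⌉₊ ≤ l := Nat.ceil_le.2 (mul_le_of_le_one_right (by positivity) hπ1)
  have hcond : ∀ i ≤ l, M * (2 : ℝ) ^ ((i : ℝ) * (r - s - p⁻¹.toReal) +
      (i - max J ⌈l * π⌉₊ : ℕ) * p⁻¹.toReal) ≤ M := fun i hi => by
    refine mul_le_of_le_one_right hM.le (Real.rpow_le_one_of_one_le_of_nonpos one_le_two ?_)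
    have h4 : (0 : ℝ) ≤ i := by positivity
    -- Up to level `a` one position is active, and `r - 1/p ≤ s` suffices. Beyond it the exponent is
    -- `i(r - s) - a/p`, nonpositive since `a ≥ lπ ≥ iπ`.
    rcases le_total i (max J ⌈l * π⌉₊) with hia | hia
    · rw [Nat.sub_eq_zero_of_le hia]
      rw [Nat.cast_zero, zero_mul, add_zero]
      exact mul_nonpos_of_nonneg_of_nonpos h4 (by linarith)
    · rw [Nat.cast_sub hia]
      have h5 : (i : ℝ) * π ≤ (max J ⌈l * π⌉₊ : ℕ) := by
        have h6 : (i : ℝ) * π ≤ l * π :=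
          mul_le_mul_of_nonneg_right (by exact_mod_cast hi) hπ0
        exact h6.trans ((Nat.le_ceil _).trans (by exact_mod_cast le_max_right _ _))
      nlinarith [mul_le_mul_of_nonneg_right h5 hq0, mul_le_mul_of_nonneg_left hru h4]
  obtain ⟨f₀, hf₀, f₁, hf₁, h₀, h₁, hH, hdiv, x, hx, hsep⟩ :=
    W.exists_hard_pair hj₀ hp hs ⟨ht0, ht1⟩ hM hB hJ hκ₀ hsupp (a := max J ⌈l * π⌉₊)
      (le_max_left _ _) (max_le hJl hlπ) hlj le_rfl
      (b := fun _ => M) (fun i => hM.le) (fun i => le_rfl) antitone_const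
      hcond A (P := P) hm (v := v) n
  refine ⟨f₀, hf₀, f₁, hf₁, h₀, h₁, hH, hdiv.trans ?_, x, hx, ?_⟩
  · refine mul_le_mul_of_nonneg_left ?_ (by positivity)
    refine (mul_le_mul_of_nonneg_right hn (by positivity)).trans ?_
    rw [mul_left_comm, ← Real.rpow_add h2]
    refine mul_le_mul_of_nonneg_left (Real.rpow_le_rpow_of_exponent_le one_le_two ?_)
      (by positivity)
    have h3 : ((max J ⌈l * π⌉₊ : ℕ) : ℝ) ≤ J + (l * π + 1) := by
      rw [Nat.cast_max]
      have h4 := (Nat.ceil_lt_add_one (a := l * π) (by positivity)).le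
      have h5 : (0 : ℝ) ≤ l * π := by positivity
      have h6 : (0 : ℝ) ≤ J := by positivity
      exact max_le (by linarith) (by linarith)
    linarith [mul_le_mul_of_nonneg_right hl1 hπ0]
  · rw [mul_assoc]; exact hsep

end WaveletBasis

/-! ### Assembly. -/

theorem theorem6 {j₀ L N : ℕ} (hj₀ : 1 ≤ j₀) (W : WaveletBasis j₀ L N)
    (p : ℝ≥0∞) (hp : 1 ≤ p) (r s t M u r' s' : ℝ)
    (hr : 1 / 2 + p⁻¹.toReal ≤ r) (hrN : r < N)
    (hs : r - p⁻¹.toReal ≤ s) (hsN : s < N)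
    (ht : t ∈ Set.Ioo (0 : ℝ) 1) (hM : 0 < M)
    (I : Set ℝ) (hI : I ⊆ Set.Icc 0 1) (hIint : I.OrdConnected) (hInt : I.Nontrivial)
    (hu : u = max (r - s) 0) (hr' : r' = s + t * u) (hs' : s' = s / (1 - p.toReal * t * u))
    (σ : ℝ≥0) (hσ : 0 < σ)
    {Ω : Type*} [MeasurableSpace Ω] (P : Measure Ω) [IsProbabilityMeasure P]
    (ε : ℕ → Ω → ℝ) (hε : iIndepFun ε P) (hεlaw : ∀ n, HasLaw (ε n) (gaussianReal 0 (σ ^ 2)) P)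
    (A : AdaptiveSensing) (c : ℕ → ℝ) (hc : ∀ n, 0 ≤ c n)
    (hrate : AchievesRate P ε A (W.sparseDetectable p r s t M I) I c) :
    (fun n : ℕ => (n : ℝ) ^ (-rateExponent (min r' s'))) =O[atTop] c := by
  have hind : iIndepFun (fun i => (hεlaw i).aemeasurable.mk (ε i)) P :=
    hε.congr fun i => (hεlaw i).aemeasurable.ae_eq_mk
  have hm := fun i => (hεlaw i).aemeasurable.measurable_mk
  have hlaw : ∀ i, P.map ((hεlaw i).aemeasurable.mk (ε i)) = gaussianReal 0 (σ ^ 2) := fun i =>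
    (Measure.map_congr (hεlaw i).aemeasurable.ae_eq_mk.symm).trans (hεlaw i).map_eq
  have hv : σ ^ 2 ≠ 0 := pow_ne_zero 2 hσ.ne'
  have hrate' := hrate.congr_noise fun i => (hεlaw i).aemeasurable.ae_eq_mk
  have hq0 : 0 ≤ p⁻¹.toReal := ENNReal.toReal_nonneg
  have hu0 : 0 ≤ u := hu ▸ le_max_right _ _
  have hru : r - s ≤ u := hu ▸ le_max_left _ _
  have huq : u ≤ p⁻¹.toReal := hu ▸ max_le (by linarith) hq0
  have hs0 : 0 < s := by linarith
  rcases le_total r' s' with hmin | hmin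
  · rw [min_eq_left hmin, rateExponent, hr']
    exact W.isBigO_of_dense_levels hj₀ hp hs hs0 ht hM hu0 hru hI hIint hInt hv hind hm hlaw A hc
      hrate'
  · have hπ1 : p.toReal * u ≤ 1 := by
      refine (mul_le_mul_of_nonneg_left huq ENNReal.toReal_nonneg).trans ?_
      rw [ENNReal.toReal_inv]
      exact mul_inv_le_one
    -- The sparse regime is used with `π = p u`. For `p = ∞` the convention `p.toReal = 0` gives `π
    -- = 0`, consistent with `u = 0` and `s' = s`.
    have hπq : u ≤ p.toReal * u * p⁻¹.toReal := by
      by_cases hp' : p = ∞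
      · simpa [hp'] using huq
      · have : p.toReal ≠ 0 := (ENNReal.toReal_pos (by positivity) hp').ne'
        rw [ENNReal.toReal_inv, mul_right_comm, mul_inv_cancel₀ this, one_mul]
    have hexp : rateExponent s' = s / (2 * s + 1 - t * (p.toReal * u)) := by
      have h1 : t * (p.toReal * u) < 1 := by nlinarith [ht.1, ht.2]
      have h2 : 1 - p.toReal * t * u = 1 - t * (p.toReal * u) := by ring
      have h3 : 1 - t * (p.toReal * u) ≠ 0 := by linarith
      have h4 : 2 * (s / (1 - t * (p.toReal * u))) + 1 =
          (2 * s + 1 - t * (p.toReal * u)) / (1 - t * (p.toReal * u)) := by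
        rw [eq_div_iff h3, add_mul, mul_assoc, div_mul_cancel₀ _ h3]
        ring
      rw [rateExponent, hs', h2, h4, div_div_div_cancel_right₀ h3]
    rw [min_eq_right hmin, hexp]
    exact W.isBigO_of_sparse_levels hj₀ hp hs hs0 ht hM (mul_nonneg ENNReal.toReal_nonneg hu0) hπ1
      (hru.trans hπq) hI hIint hInt hv hind hm hlaw A hc hrate'
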